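/- Write $\langle k\rangle=\sqrt{1+k^2}$, $\hat u(k)=\int_{\mathbb R}e^{-\mathrm ikx}u(x)\,\mathrm dx$ for the Fourier transform (extended to $L^2(\mathbb R)$ by density), $\mathcal F^{-1}$ for its inverse, and $\|g\|_{L^1\cap L^\infty}=\max(\|g\|_{L^1},\|g\|_{L^\infty})$. Let $d>0$ and $\hat B\in L^\infty(\mathbb R^2)$ (complex-valued). Let $\lambda(\partial_x)$ be the Fourier multiplier with symbol $\hat\lambda(k)=-dk^2-\mathrm i\langle k\rangle$, and let $B$ be the bilinear form $B(u_1,u_2)=\mathcal F^{-1}\big(k\mapsto\int_{\mathbb R}\hat B(k,l)\,\hat u_1(k-l)\,\hat u_2(l)\,\mathrm dl\big)$. Consider the viscous half Klein–Gordon equation $$\partial_t u-\lambda(\partial_x)u=B(u,u),\qquad t\ge 0,\ x\in\mathbb R,\ u(t,x)\in\mathbb C.$$ A global mild solution with initial condition $u_0\in L^2(\mathbb R)$ is a function $u\in C([0,\infty),L^2(\mathbb R))$ such that for all $t\ge 0$ $$u(t)=e^{t\lambda(\partial_x)}u_0+\int_0^t e^{(t-s)\lambda(\partial_x)}B(u(s),u(s))\,\mathrm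 ds,$$ where $e^{t\lambda(\partial_x)}$ is the Fourier multiplier with symbol $e^{t\hat\lambda}$ and the integral is a Bochner integral in $L^2(\mathbb R)$ (for $0\le s<t$ the integrand lies in $L^2(\mathbb R)$, since the Fourier transform of $B(u(s),u(s))$ is bounded). Theorem. There exist $\delta>0$ and $C>0$ (depending only on $d$ and $\hat B$) such that, if $u_0\in L^2(\mathbb R)$ satisfies $\hat u_0\in L^1(\mathbb R)\cap L^\infty(\mathbb R)$ with $E_0:=\|\hat u_0\|_{L^1\cap L^\infty}\le\delta$, then there exists a unique global mild solution $u\in C([0,\infty),L^2(\mathbb R))$ of the equation with initial condition $u_0$. Furthermore, $\hat u(t)\in L^1(\mathbb R)\cap L^\infty(\mathbb R)$ and $$\|u(t)\|_{L^\infty}\le\|\hat u(t)\|_{L^1}\le CE_0(1+t)^{-1/2},\qquad \|u(t)\|_{L^2}\le CE_0(1+t)^{-1/4},\qquad \|\hat u(t)\|_{L^\infty}\le CE_0$$ for all $t\ge 0$. -/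

import Mathlib

open MeasureTheory FourierTransform
open scoped ENNReal NNReal

noncomputable section

namespace HalfKleinGordon

/-- The Hilbert space `L²(ℝ)` of complex-valued functions. -/
abbrev L2 : Type := Lp ℂ 2 (volume : Measure ℝ)

/-- The Fourier transform on `L²(ℝ)` in the normalization `û(k) = ∫ e^{-ikx} u(x) dx`
(extended to `L²` by density). Mathlib's `𝓕` uses `e^{-2πi ξ x}`, so `û(k) = (𝓕 u)(k / 2π)`. -/
def FT (u : L2) : ℝ → ℂ := fun k => (𝓕 u : L2) (k / (2 * Real.pi))

/-- The inverse of `FT`: for `g ∈ L²(ℝ)` this is the element of `L²(ℝ)` with Fourier transform `g`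
(see `FT_invFT`). For other functions `g` it is `0`. -/
def invFT (g : ℝ → ℂ) : L2 :=
  open Classical in
  if h : MemLp (fun ξ : ℝ => g (2 * Real.pi * ξ)) 2 volume then 𝓕⁻ (h.toLp _ : L2) else 0

/-- The Fourier symbol `-d k² - i ⟨k⟩` with `⟨k⟩ = √(1 + k²)`. -/
def symbol (d k : ℝ) : ℂ :=
  -((d * k ^ 2 : ℝ) : ℂ) - Complex.I * ((Real.sqrt (1 + k ^ 2) : ℝ) : ℂ)

/-- The Fourier transform `k ↦ ∫ B̂(k,l) û₁(k-l) û₂(l) dl` of the bilinear form `B(u₁,u₂)`. -/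
def bilinHat (B : ℝ × ℝ → ℂ) (u₁ u₂ : L2) : ℝ → ℂ :=
  fun k => ∫ l : ℝ, B (k, l) * FT u₁ (k - l) * FT u₂ l

/-- The linear semigroup `e^{tλ(∂ₓ)}` on `L²(ℝ)`, the Fourier multiplier with symbol `e^{tλ̂}`. -/
def semigroup (d t : ℝ) (u : L2) : L2 :=
  invFT (fun k => Complex.exp (t * symbol d k) * FT u k)

/-- `e^{τλ(∂ₓ)} B(u₁,u₂)` for `τ > 0`, the Fourier multiplier `e^{τλ̂}` applied to `B(u₁,u₂)`.
For `u₁, u₂ ∈ L²` the Fourier transform of `B(u₁,u₂)` is merely bounded, but after multiplication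
by `e^{τλ̂}` it lies in `L²` (see `memLp_semigroupBilin`). -/
def semigroupBilin (d : ℝ) (B : ℝ × ℝ → ℂ) (τ : ℝ) (u₁ u₂ : L2) : L2 :=
  invFT (fun k => Complex.exp (τ * symbol d k) * bilinHat B u₁ u₂ k)

/-- `u ∈ C([0,∞), L²)` is a global mild solution of `∂ₜu - λ(∂ₓ)u = B(u,u)`, `u(0) = u₀`:
`u(t) = e^{tλ(∂ₓ)} u₀ + ∫₀ᵗ e^{(t-s)λ(∂ₓ)} B(u(s),u(s)) ds` for all `t ≥ 0`,
with a Bochner integral in `L²(ℝ)`. -/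
def IsMildSolution (d : ℝ) (B : ℝ × ℝ → ℂ) (u₀ : L2) (u : C(ℝ≥0, L2)) : Prop :=
  ∀ t : ℝ≥0,
    IntervalIntegrable
      (fun s : ℝ => semigroupBilin d B (t - s) (u s.toNNReal) (u s.toNNReal)) volume 0 t ∧
    u t = semigroup d t u₀ +
      ∫ s in (0 : ℝ)..t, semigroupBilin d B (t - s) (u s.toNNReal) (u s.toNNReal)

/-- The norm of `L¹(ℝ) ∩ L^∞(ℝ)`, with values in `[0,∞]`. -/
def normL1Linf (g : ℝ → ℂ) : ℝ≥0∞ := max (eLpNorm g 1 volume) (eLpNorm g ∞ volume)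

/-! ### The operators above never take their default values -/

theorem quasi_mul {a : ℝ} (ha : a ≠ 0) :
    Measure.QuasiMeasurePreserving (fun x : ℝ => a * x) volume volume :=
  ⟨measurable_const_mul a, by
    rw [Real.map_volume_mul_left ha]; exact Measure.smul_absolutelyContinuous⟩

theorem memLp_comp_mul {g : ℝ → ℂ} {p : ℝ≥0∞} {a : ℝ} (ha : a ≠ 0) (hg : MemLp g p volume) :
    MemLp (fun x => g (a * x)) p volume := by
  have : MemLp g p (Measure.map (fun x : ℝ => a * x) volume) := by
    rw [Real.map_volume_mul_left ha]
    exact hg.smul_measure ENNReal.ofReal_ne_top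
  exact this.comp_of_map (measurable_const_mul a).aemeasurable

theorem memLp_FT (u : L2) : MemLp (FT u) 2 volume := by
  have h := memLp_comp_mul (a := (2 * Real.pi)⁻¹) (by positivity) (Lp.memLp (𝓕 u : L2))
  have e : FT u = fun x => (𝓕 u : L2) ((2 * Real.pi)⁻¹ * x) := by
    funext x; simp only [FT, div_eq_inv_mul]
  rw [e]; exact h

theorem FT_invFT {g : ℝ → ℂ} (hg : MemLp g 2 volume) : FT (invFT g) =ᵐ[volume] g := by
  have hpi : (2 * Real.pi) ≠ 0 := by positivity
  have h := memLp_comp_mul hpi hg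
  have h1 := h.coeFn_toLp
  have e : (𝓕 (invFT g) : L2) = h.toLp _ := by
    rw [invFT, dif_pos h]; exact fourier_fourierInv_eq _
  have h2 := (quasi_mul (inv_ne_zero hpi)).ae h1
  filter_upwards [h2] with k hk
  simp only [FT, e, div_eq_inv_mul]
  rw [hk]
  congr 1
  field_simp

theorem invFT_FT (u : L2) : invFT (FT u) = u := by
  have hpi : (2 * Real.pi) ≠ 0 := by positivity
  have h := memLp_comp_mul hpi (memLp_FT u)
  have e : (h.toLp _ : L2) = 𝓕 u := by
    apply Lp.ext
    filter_upwards [h.coeFn_toLp] with x hx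
    rw [hx]
    simp only [FT]
    congr 1
    field_simp
  rw [invFT, dif_pos h, e]; exact fourierInv_fourier_eq u

theorem norm_exp_symbol (d t k : ℝ) :
    ‖Complex.exp (t * symbol d k)‖ = Real.exp (-(t * d) * k ^ 2) := by
  rw [Complex.norm_exp]
  congr 1
  simp only [symbol, Complex.mul_re, Complex.sub_re, Complex.neg_re, Complex.ofReal_re,
    Complex.ofReal_im, Complex.I_re, Complex.I_im]
  ring

theorem continuous_exp_symbol (d t : ℝ) :
    Continuous fun k : ℝ => Complex.exp (t * symbol d k) := by
  unfold symbol; fun_prop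

theorem memLp_semigroup {d t : ℝ} (hd : 0 < d) (ht : 0 ≤ t) (u : L2) :
    MemLp (fun k => Complex.exp (t * symbol d k) * FT u k) 2 volume := by
  refine (memLp_FT u).of_le
    ((continuous_exp_symbol d t).aestronglyMeasurable.mul (memLp_FT u).1) ?_
  refine Filter.Eventually.of_forall fun k => ?_
  rw [norm_mul, norm_exp_symbol]
  have : Real.exp (-(t * d) * k ^ 2) ≤ 1 := by
    rw [Real.exp_le_one_iff]; nlinarith [mul_nonneg (mul_nonneg ht hd.le) (sq_nonneg k)]
  exact mul_le_of_le_one_left (norm_nonneg _) this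

theorem measurable_FT (u : L2) : Measurable (FT u) :=
  (Lp.stronglyMeasurable (𝓕 u : L2)).measurable.comp (measurable_id.div_const _)

theorem integrable_bilin {B : ℝ × ℝ → ℂ} (hB : MemLp B ∞ volume) (u₁ u₂ : L2) :
    ∀ᵐ k : ℝ, Integrable (fun l : ℝ => B (k, l) * FT u₁ (k - l) * FT u₂ l) volume := by
  have hbd := ae_le_eLpNormEssSup (f := B) (μ := volume)
  have h1 := hB.1
  rw [Measure.volume_eq_prod] at h1 hbd
  filter_upwards [h1.prodMk_left, Measure.ae_ae_of_ae_prod hbd] with k hk hk'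
  have h3 : MemLp (fun l => B (k, l)) ∞ volume := by
    refine memLp_top_of_bound hk (eLpNorm B ∞ volume).toReal ?_
    filter_upwards [hk'] with l hl
    rw [← toReal_enorm]
    refine ENNReal.toReal_mono hB.2.ne ?_
    rw [eLpNorm_exponent_top]; exact hl
  have h4 : MemLp (fun l => FT u₁ (k - l)) 2 volume :=
    (memLp_FT u₁).comp_measurePreserving (Measure.measurePreserving_sub_left volume k)
  exact memLp_one_iff_integrable.1 ((memLp_FT u₂).mul (h4.mul (r := 2) h3))

theorem memLp_bilinHat {B : ℝ × ℝ → ℂ} (hB : MemLp B ∞ volume) (u₁ u₂ : L2) :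
    MemLp (bilinHat B u₁ u₂) ∞ volume := by
  have hbd := ae_le_eLpNormEssSup (f := B) (μ := volume)
  have h1 := hB.1
  rw [Measure.volume_eq_prod] at h1 hbd
  have hm : AEStronglyMeasurable
      (fun p : ℝ × ℝ => B p * FT u₁ (p.1 - p.2) * FT u₂ p.2)
      ((volume : Measure ℝ).prod volume) :=
    (h1.mul ((measurable_FT u₁).comp
      (measurable_fst.sub measurable_snd)).aestronglyMeasurable).mul
      ((measurable_FT u₂).comp measurable_snd).aestronglyMeasurable
  set M := (eLpNorm B ∞ volume).toReal
  have i1 : Integrable (fun l => ‖FT u₁ l‖ ^ 2) volume :=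
    (memLp_two_iff_integrable_sq_norm (memLp_FT u₁).1).1 (memLp_FT u₁)
  have i2 : Integrable (fun l => ‖FT u₂ l‖ ^ 2) volume :=
    (memLp_two_iff_integrable_sq_norm (memLp_FT u₂).1).1 (memLp_FT u₂)
  refine memLp_top_of_bound hm.integral_prod_right'
    (M * ((∫ l, ‖FT u₁ l‖ ^ 2) + ∫ l, ‖FT u₂ l‖ ^ 2)) ?_
  filter_upwards [Measure.ae_ae_of_ae_prod hbd] with k hk
  rw [← integral_sub_left_eq_self (fun l => ‖FT u₁ l‖ ^ 2) volume k,
    ← integral_add (i1.comp_sub_left k) i2, ← integral_const_mul]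
  refine norm_integral_le_of_norm_le (((i1.comp_sub_left k).add i2).const_mul M) ?_
  filter_upwards [hk] with l hl
  have hl' : ‖B (k, l)‖ ≤ M := by
    rw [← toReal_enorm]
    refine ENNReal.toReal_mono hB.2.ne ?_
    rw [eLpNorm_exponent_top]; exact hl
  rw [norm_mul, norm_mul, mul_assoc]
  refine mul_le_mul hl' ?_ (by positivity) ENNReal.toReal_nonneg
  nlinarith [sq_nonneg (‖FT u₁ (k - l)‖ - ‖FT u₂ l‖), sq_nonneg (‖FT u₁ (k - l)‖),
    sq_nonneg (‖FT u₂ l‖)]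

theorem memLp_semigroupBilin {d τ : ℝ} (hd : 0 < d) (hτ : 0 < τ) {B : ℝ × ℝ → ℂ}
    (hB : MemLp B ∞ volume) (u₁ u₂ : L2) :
    MemLp (fun k => Complex.exp (τ * symbol d k) * bilinHat B u₁ u₂ k) 2 volume := by
  have h1 : MemLp (fun k : ℝ => Complex.exp (τ * symbol d k)) 2 volume := by
    rw [memLp_two_iff_integrable_sq_norm (continuous_exp_symbol d τ).aestronglyMeasurable]
    have := integrable_exp_neg_mul_sq (b := 2 * (τ * d)) (by positivity)
    refine this.congr (Filter.Eventually.of_forall fun k => ?_)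
    simp only [norm_exp_symbol, ← Real.exp_nat_mul]
    congr 1; push_cast; ring
  exact (memLp_bilinHat hB u₁ u₂).mul h1

end HalfKleinGordon

end

noncomputable section

namespace HalfKleinGordon

open Filter Topology

/-! Heat decay alone does not control the quadratic term: if `‖û(t)‖_{L¹}` is of size `(1+t)^{-1/2}`
and `‖û(t)‖_{L^∞}` is bounded, the direct Duhamel bound in `L^∞` grows like `∫₀ᵗ (1+s)^{-1/2} ds`.
The remedy is non-resonance. At low frequency the linear flow oscillates like `e^{-it}`, while
`B(u,u)` oscillates like `e^{-2it}`. With `û(t) = e^{-it} g(t)`, `f = û₀` and `S(z) = e^{z(λ̂+i)}`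
the equation becomes `g(t) = S(t) f + ∫₀ᵗ e^{-is} S(t-s) B(g,g)(s) ds`.

The oscillation of `e^{-is}` is exploited by making time complex. For `Re z ≥ 0` and `Im z ≤ 0` the
operator `S(z)` is a contraction, and `|e^{-is}| = e^{Im s}` decays downwards. Since `B` involves no
complex conjugate, the equation can be solved by functions `g` that are holomorphic in the open
quadrant and continuous up to its boundary. For `|k| ≤ 1`, Cauchy's theorem (`pathIntegral_eq_deep`)
replaces the path from `0` to `z` by one that descends from `0`, crosses at depth `Re z - Im z` and
ascends to `z`. On it the growth of `S(z-s)`, of rate at most `1/2`, loses against `e^{Im s}`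
(`lpBound_low_kernel`). Only neighbourhoods of `Re s = 0` and `Re s = Re z` contribute, up to an
exponentially small term, so no factor of elapsed time appears. For `|k| > 1` diffusion gives
exponential decay on the original path.

The resulting estimates `lpBound_duhamel` and `lpBound_duhamel_decay` make the mild map a
contraction on `solutionSpace` (`exists_demodulated_solution`). Restriction to real times gives the
solution (`exists_mildSolution`), and `‖u‖_{L²}² ≤ ‖û‖_{L¹} ‖û‖_{L^∞}` gives the `L²` rate.

Uniqueness among all continuous `L²`-valued solutions is independent of this: Cauchy–Schwarz and
Gaussian smoothing yield a Grönwall inequality with kernel `(t-s)^{-1/4}` (`mildSolution_unique`).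
-/

/-- The Banach space `L¹(ℝ)` of complex-valued functions. -/
abbrev L1 : Type := Lp ℂ 1 (volume : Measure ℝ)

/-! ### `L¹` and `L^∞` bounds for elements of `L¹`, and their stability under integrals and limits
-/

/-- `‖f‖_{Lᵖ} ≤ c` for `f ∈ L¹(ℝ)`. -/
def LpBound (p : ℝ≥0∞) (f : L1) (c : ℝ) : Prop := eLpNorm f p volume ≤ ENNReal.ofReal c

theorem lpBound_one_iff {f : L1} {c : ℝ} (hc : 0 ≤ c) : LpBound 1 f c ↔ ‖f‖ ≤ c := by
  rw [LpBound, Lp.norm_def, ENNReal.le_ofReal_iff_toReal_le (Lp.eLpNorm_ne_top f) hc]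

theorem lpBound_norm (f : L1) : LpBound 1 f ‖f‖ := (lpBound_one_iff (norm_nonneg f)).2 le_rfl

theorem LpBound.norm_le {f : L1} {c : ℝ} (h : LpBound 1 f c) (hc : 0 ≤ c) : ‖f‖ ≤ c :=
  (lpBound_one_iff hc).1 h

theorem lpBound_top_iff {f : L1} {c : ℝ} (hc : 0 ≤ c) :
    LpBound ∞ f c ↔ ∀ᵐ x, ‖f x‖ ≤ c := by
  rw [LpBound, eLpNorm_exponent_top]
  refine ⟨fun h => ?_, eLpNormEssSup_le_of_ae_bound⟩
  filter_upwards [ae_le_eLpNormEssSup (f := (f : ℝ → ℂ)) (μ := volume)] with x hx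
  have := hx.trans h
  rwa [← ofReal_norm, ENNReal.ofReal_le_ofReal_iff hc] at this

theorem LpBound.mono {p : ℝ≥0∞} {f : L1} {c c' : ℝ} (h : LpBound p f c) (hc : c ≤ c') :
    LpBound p f c' := le_trans h (ENNReal.ofReal_le_ofReal hc)

theorem lpBound_zero (p : ℝ≥0∞) (c : ℝ) : LpBound p 0 c := by
  rw [LpBound, eLpNorm_congr_ae (Lp.coeFn_zero ℂ 1 volume), eLpNorm_zero]
  exact bot_le

theorem LpBound.add {p : ℝ≥0∞} (hp : 1 ≤ p) {f g : L1} {c c' : ℝ} (h : LpBound p f c)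
    (h' : LpBound p g c') (hc : 0 ≤ c) (hc' : 0 ≤ c') : LpBound p (f + g) (c + c') := by
  rw [LpBound, eLpNorm_congr_ae (Lp.coeFn_add f g), ENNReal.ofReal_add hc hc']
  exact (eLpNorm_add_le (Lp.aestronglyMeasurable f) (Lp.aestronglyMeasurable g) hp).trans
    (add_le_add h h')

theorem lpBound_of_ae_le {p : ℝ≥0∞} {f g : L1} {m c : ℝ} (h : LpBound p f c) (hm : 0 ≤ m)
    (hfg : ∀ᵐ x, ‖g x‖ ≤ m * ‖f x‖) : LpBound p g (m * c) := by
  rw [LpBound, ENNReal.ofReal_mul hm]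
  exact (eLpNorm_le_mul_eLpNorm_of_ae_le_mul hfg p).trans (by gcongr; exact h)

theorem LpBound.smul {p : ℝ≥0∞} {f : L1} {c : ℝ} (h : LpBound p f c) (w : ℂ) :
    LpBound p (w • f) (‖w‖ * c) := by
  refine lpBound_of_ae_le h (norm_nonneg w) ?_
  filter_upwards [Lp.coeFn_smul w f] with x hx
  rw [hx, Pi.smul_apply, norm_smul]

theorem LpBound.smul_le {p : ℝ≥0∞} {f : L1} {c m : ℝ} (h : LpBound p f c) {w : ℂ}
    (hw : ‖w‖ ≤ m) (hc : 0 ≤ c) : LpBound p (w • f) (m * c) :=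
  (h.smul w).mono (by gcongr)

/-- Integration over a set as a continuous linear functional on `L¹`. -/
def setIntegralL1 (A : Set ℝ) : L1 →L[ℝ] ℂ :=
  L1.integralCLM.comp (LpToLpRestrictCLM ℝ ℂ ℝ volume 1 A)

theorem setIntegralL1_apply (A : Set ℝ) (f : L1) : setIntegralL1 A f = ∫ x in A, f x := by
  have : setIntegralL1 A f = L1.integral (LpToLpRestrictCLM ℝ ℂ ℝ volume 1 A f) := by
    rw [L1.integral_eq]; rfl
  rw [this, L1.integral_eq_integral]
  exact integral_congr_ae (LpToLpRestrictCLM_coeFn ℝ A f)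

theorem integrable_L1 (f : L1) : Integrable f volume := L1.integrable_coeFn f

/-- By Lebesgue differentiation, averages over shrinking balls recover `f` almost everywhere. In
this form an `L^∞` bound is a family of conditions on continuous functionals of `L¹`; hence it
passes under `L¹`-valued Bochner integrals and to `L¹` limits. -/
theorem lpBound_top_iff_setIntegral {f : L1} {c : ℝ} (hc : 0 ≤ c) :
    LpBound ∞ f c ↔ ∀ A : Set ℝ, MeasurableSet A → volume A < ∞ →
      ‖setIntegralL1 A f‖ ≤ c * (volume A).toReal := by
  rw [lpBound_top_iff hc]
  constructor
  · intro h A hA hA'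
    rw [setIntegralL1_apply]
    exact norm_setIntegral_le_of_norm_le_const_ae' hA' (h.mono fun x hx _ => hx)
  · intro h
    filter_upwards [IsUnifLocDoublingMeasure.ae_tendsto_average volume
      (integrable_L1 f).locallyIntegrable 1] with x hx
    have hδ : Tendsto (fun n : ℕ => 1 / ((n : ℝ) + 1)) atTop (𝓝[>] 0) :=
      tendsto_nhdsWithin_iff.2 ⟨tendsto_one_div_add_atTop_nhds_zero_nat,
        Eventually.of_forall fun n => by simp only [Set.mem_Ioi]; positivity⟩
    have := hx (fun _ => x) _ hδ (Eventually.of_forall fun n => by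
      refine Metric.mem_closedBall_self (by positivity))
    refine le_of_tendsto this.norm (Eventually.of_forall fun n => ?_)
    have hpos : (0 : ℝ) < 1 / ((n : ℝ) + 1) := by positivity
    have hv : volume (Metric.closedBall x (1 / ((n : ℝ) + 1))) =
        ENNReal.ofReal (2 * (1 / ((n : ℝ) + 1))) := Real.volume_closedBall x _
    have h1 := h (Metric.closedBall x (1 / ((n : ℝ) + 1))) Metric.isClosed_closedBall.measurableSet
      (by rw [hv]; exact ENNReal.ofReal_lt_top)
    rw [setIntegralL1_apply] at h1
    rw [setAverage_eq, norm_smul, measureReal_def, hv, ENNReal.toReal_ofReal (by positivity)]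
    rw [hv, ENNReal.toReal_ofReal (by positivity)] at h1
    rw [Real.norm_of_nonneg (by positivity), inv_mul_le_iff₀ (by positivity)]
    linarith

theorem lpBound_intervalIntegral_one {h : ℝ → L1} {c : ℝ → ℝ} {a b : ℝ} (hab : a ≤ b)
    (hc : IntervalIntegrable c volume a b) (hc0 : ∀ s ∈ Set.Icc a b, 0 ≤ c s)
    (hb : ∀ s ∈ Set.Icc a b, LpBound 1 (h s) (c s)) :
    LpBound 1 (∫ s in a..b, h s) (∫ s in a..b, c s) := by
  rw [lpBound_one_iff (intervalIntegral.integral_nonneg hab hc0)]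
  refine intervalIntegral.norm_integral_le_of_norm_le hab ?_ hc
  refine Eventually.of_forall fun s hs => ?_
  have hs' := Set.Ioc_subset_Icc_self hs
  exact (hb s hs').norm_le (hc0 s hs')

theorem lpBound_intervalIntegral_top {h : ℝ → L1} {c : ℝ → ℝ} {a b : ℝ} (hab : a ≤ b)
    (hh : IntervalIntegrable h volume a b)
    (hc : IntervalIntegrable c volume a b) (hc0 : ∀ s ∈ Set.Icc a b, 0 ≤ c s)
    (hb : ∀ s ∈ Set.Icc a b, LpBound ∞ (h s) (c s)) :
    LpBound ∞ (∫ s in a..b, h s) (∫ s in a..b, c s) := by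
  rw [lpBound_top_iff_setIntegral (intervalIntegral.integral_nonneg hab hc0)]
  intro A hA hA'
  rw [← ContinuousLinearMap.intervalIntegral_comp_comm _ hh,
    ← intervalIntegral.integral_mul_const]
  refine intervalIntegral.norm_integral_le_of_norm_le hab ?_ (hc.mul_const _)
  refine Eventually.of_forall fun s hs => ?_
  have hs' := Set.Ioc_subset_Icc_self hs
  exact (lpBound_top_iff_setIntegral (hc0 s hs')).1 (hb s hs') A hA hA'

theorem lpBound_intervalIntegral {p : ℝ≥0∞} (hp : p = 1 ∨ p = ∞) {h : ℝ → L1} {c : ℝ → ℝ}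
    {a b : ℝ} (hab : a ≤ b) (hh : IntervalIntegrable h volume a b)
    (hc : IntervalIntegrable c volume a b) (hc0 : ∀ s ∈ Set.Icc a b, 0 ≤ c s)
    (hb : ∀ s ∈ Set.Icc a b, LpBound p (h s) (c s)) :
    LpBound p (∫ s in a..b, h s) (∫ s in a..b, c s) := by
  rcases hp with rfl | rfl
  · exact lpBound_intervalIntegral_one hab hc hc0 hb
  · exact lpBound_intervalIntegral_top hab hh hc hc0 hb

theorem isClosed_lpBound {p : ℝ≥0∞} (hp : p = 1 ∨ p = ∞) {c : ℝ} (hc : 0 ≤ c) :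
    IsClosed {f : L1 | LpBound p f c} := by
  rcases hp with rfl | rfl
  · simp only [lpBound_one_iff hc]
    exact isClosed_le continuous_norm continuous_const
  · simp only [lpBound_top_iff_setIntegral hc, Set.ofPred_forall]
    exact isClosed_iInter fun A => isClosed_iInter fun _ => isClosed_iInter fun _ =>
      isClosed_le (setIntegralL1 A).continuous.norm continuous_const

/-! ### Multiplication operators on `L¹` -/

/-- Multiplication of an `L¹` function by an `L^∞` function. -/
def mulLinf : Lp ℂ ∞ (volume : Measure ℝ) →L[ℂ] L1 →L[ℂ] L1 :=
  (ContinuousLinearMap.mul ℂ ℂ).holderL volume ∞ 1 1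

theorem mulLinf_coeFn (φ : Lp ℂ ∞ (volume : Measure ℝ)) (f : L1) :
    mulLinf φ f =ᵐ[volume] fun x => φ x * f x :=
  ContinuousLinearMap.coeFn_holder (r := 1) (ContinuousLinearMap.mul ℂ ℂ) φ f

/-- Multiplication of `L¹` functions by `φ` (the zero operator if `φ` is not in `L^∞`). -/
def mulOp (φ : ℝ → ℂ) : L1 →L[ℂ] L1 :=
  open Classical in if h : MemLp φ ∞ volume then mulLinf (h.toLp φ) else 0

theorem mulOp_coeFn {φ : ℝ → ℂ} (h : MemLp φ ∞ volume) (f : L1) :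
    mulOp φ f =ᵐ[volume] fun x => φ x * f x := by
  rw [mulOp, dif_pos h]
  filter_upwards [mulLinf_coeFn (h.toLp φ) f, h.coeFn_toLp] with x h1 h2
  rw [h1, h2]

theorem lpBound_mulOp {p : ℝ≥0∞} {φ : ℝ → ℂ} (h : MemLp φ ∞ volume) {m c : ℝ} (hm : 0 ≤ m)
    (hφ : ∀ k, ‖φ k‖ ≤ m) {f : L1} (hf : LpBound p f c) : LpBound p (mulOp φ f) (m * c) := by
  refine lpBound_of_ae_le hf hm ?_
  filter_upwards [mulOp_coeFn h f] with x hx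
  rw [hx, norm_mul]
  gcongr
  exact hφ x

theorem mulOp_mulOp {φ ψ χ : ℝ → ℂ} (hφ : MemLp φ ∞ volume) (hψ : MemLp ψ ∞ volume)
    (hχ : MemLp χ ∞ volume) (h : ∀ x, χ x = φ x * ψ x) (f : L1) :
    mulOp φ (mulOp ψ f) = mulOp χ f := by
  apply Lp.ext
  filter_upwards [mulOp_coeFn hφ (mulOp ψ f), mulOp_coeFn hψ f, mulOp_coeFn hχ f] with x h1 h2 h3
  rw [h1, h2, h3, h, mul_assoc]

theorem mulOp_add_apply {φ ψ χ : ℝ → ℂ} (hφ : MemLp φ ∞ volume) (hψ : MemLp ψ ∞ volume)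
    (hχ : MemLp χ ∞ volume) (h : ∀ x, χ x = φ x + ψ x) (f : L1) :
    mulOp χ f = mulOp φ f + mulOp ψ f := by
  apply Lp.ext
  filter_upwards [mulOp_coeFn hφ f, mulOp_coeFn hψ f, mulOp_coeFn hχ f,
    Lp.coeFn_add (mulOp φ f) (mulOp ψ f)] with x h1 h2 h3 h4
  rw [h4, Pi.add_apply, h1, h2, h3, h, add_mul]

/-- Dominated convergence for multiplication operators. -/
theorem tendsto_mulOp {ι : Type*} {l : Filter ι} [l.IsCountablyGenerated] {φ : ι → ℝ → ℂ}
    {ψ : ℝ → ℂ} (hφ : ∀ i, MemLp (φ i) ∞ volume) (hψ : MemLp ψ ∞ volume) {m : ℝ}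
    (hm : ∀ i k, ‖φ i k‖ ≤ m) (hlim : ∀ k, Tendsto (fun i => φ i k) l (𝓝 (ψ k))) (f : L1) :
    Tendsto (fun i => mulOp (φ i) f) l (𝓝 (mulOp ψ f)) := by
  rcases l.eq_or_neBot with rfl | hl
  · exact tendsto_bot
  rw [tendsto_iff_norm_sub_tendsto_zero]
  have hm' : ∀ k, ‖ψ k‖ ≤ m := fun k =>
    le_of_tendsto (hlim k).norm (Eventually.of_forall fun i => hm i k)
  have e : ∀ i, ‖mulOp (φ i) f - mulOp ψ f‖ = ∫ x, ‖φ i x - ψ x‖ * ‖f x‖ := by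
    intro i
    rw [L1.norm_eq_integral_norm]
    apply integral_congr_ae
    filter_upwards [mulOp_coeFn (hφ i) f, mulOp_coeFn hψ f,
      Lp.coeFn_sub (mulOp (φ i) f) (mulOp ψ f)] with x h1 h2 h3
    rw [h3, Pi.sub_apply, h1, h2, ← sub_mul, norm_mul]
  simp only [e]
  have h0 : (0 : ℝ) = ∫ x : ℝ, (0 : ℝ) := by simp
  rw [h0]
  refine tendsto_integral_filter_of_dominated_convergence (fun x => (m + m) * ‖f x‖) ?_ ?_ ?_ ?_
  · exact Eventually.of_forall fun i =>
      (((hφ i).1.sub hψ.1).norm).mul (Lp.aestronglyMeasurable f).norm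
  · refine Eventually.of_forall fun i => Eventually.of_forall fun x => ?_
    rw [norm_mul, norm_norm, norm_norm]
    gcongr
    exact (norm_sub_le _ _).trans (add_le_add (hm i x) (hm' x))
  · exact (integrable_L1 f).norm.const_mul _
  · refine Eventually.of_forall fun x => ?_
    have := (tendsto_iff_norm_sub_tendsto_zero.1 (hlim x)).mul_const ‖f x‖
    simpa using this

/-! ### The semigroup in complex time -/

/-- The symbol `λ̂(k) + i = -d k² - i (⟨k⟩ - 1)` of the demodulated equation. -/
def shiftedSymbol (d k : ℝ) : ℂ := symbol d k + Complex.I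

theorem continuous_shiftedSymbol (d : ℝ) : Continuous (shiftedSymbol d) := by
  unfold shiftedSymbol symbol; fun_prop

theorem norm_exp_shiftedSymbol (d k : ℝ) (z : ℂ) :
    ‖Complex.exp (z * shiftedSymbol d k)‖ =
      Real.exp (-(z.re * d) * k ^ 2 + z.im * (Real.sqrt (1 + k ^ 2) - 1)) := by
  rw [Complex.norm_exp]
  congr 1
  simp only [shiftedSymbol, symbol, Complex.mul_re, Complex.sub_re, Complex.neg_re,
    Complex.ofReal_re, Complex.ofReal_im, Complex.I_re, Complex.I_im, Complex.add_re,
    Complex.add_im, Complex.sub_im, Complex.neg_im, Complex.mul_im]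
  ring

theorem one_le_sqrt_one_add_sq (k : ℝ) : 1 ≤ Real.sqrt (1 + k ^ 2) := by
  rw [Real.one_le_sqrt]; nlinarith [sq_nonneg k]

/-- The closed quadrant of complex times on which the semigroup is bounded. -/
def quadrant : Set ℂ := {z | 0 ≤ z.re ∧ z.im ≤ 0}

/-- The open quadrant of complex times. -/
def openQuadrant : Set ℂ := {z | 0 < z.re ∧ z.im < 0}

theorem isOpen_openQuadrant : IsOpen openQuadrant :=
  (isOpen_lt continuous_const Complex.continuous_re).inter
    (isOpen_lt Complex.continuous_im continuous_const)

theorem openQuadrant_subset {z : ℂ} (hz : z ∈ openQuadrant) : z ∈ quadrant :=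
  ⟨hz.1.le, hz.2.le⟩

/-- The retraction of `ℂ` onto the closed quadrant. -/
def clamp (z : ℂ) : ℂ := ⟨max z.re 0, min z.im 0⟩

theorem clamp_mem (z : ℂ) : clamp z ∈ quadrant := ⟨le_max_right _ _, min_le_right _ _⟩

theorem clamp_of_mem {z : ℂ} (hz : z ∈ quadrant) : clamp z = z :=
  Complex.ext (max_eq_left hz.1) (min_eq_left hz.2)

theorem continuous_clamp : Continuous clamp := by
  have : clamp = fun z : ℂ => ((max z.re 0 : ℝ) : ℂ) + ((min z.im 0 : ℝ) : ℂ) * Complex.I := by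
    funext z; exact Complex.ext (by simp [clamp]) (by simp [clamp])
  rw [this]
  fun_prop

/-- Since `⟨k⟩ - 1 ≥ 0`, the dispersive part acts as damping in the direction of negative imaginary
time. -/
theorem norm_exp_shiftedSymbol_le {d : ℝ} {z : ℂ} (hz : z ∈ quadrant) (k : ℝ) :
    ‖Complex.exp (z * shiftedSymbol d k)‖ ≤ Real.exp (-(z.re * d) * k ^ 2) := by
  rw [norm_exp_shiftedSymbol]
  refine Real.exp_le_exp.2 ?_
  nlinarith [mul_nonneg (neg_nonneg.2 hz.2) (sub_nonneg.2 (one_le_sqrt_one_add_sq k))]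

theorem norm_exp_shiftedSymbol_le_one {d : ℝ} (hd : 0 ≤ d) {z : ℂ} (hz : z ∈ quadrant) (k : ℝ) :
    ‖Complex.exp (z * shiftedSymbol d k)‖ ≤ 1 := by
  refine (norm_exp_shiftedSymbol_le hz k).trans (Real.exp_le_one_iff.2 ?_)
  nlinarith [mul_nonneg (mul_nonneg hz.1 hd) (sq_nonneg k)]

theorem continuous_exp_shiftedSymbol (d : ℝ) (z : ℂ) :
    Continuous fun k : ℝ => Complex.exp (z * shiftedSymbol d k) := by
  have := continuous_shiftedSymbol d
  fun_prop

/-- The Fourier side of the demodulated semigroup at the complex time `z` (clamped to the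
quadrant). -/
def semigroupOp (d : ℝ) (z : ℂ) : L1 →L[ℂ] L1 :=
  mulOp fun k => Complex.exp (clamp z * shiftedSymbol d k)

/-- The low-frequency part `|k| ≤ K` of the demodulated semigroup, an entire function of `z`. -/
def lowOp (d K : ℝ) (z : ℂ) : L1 →L[ℂ] L1 :=
  mulOp ((Set.Icc (-K) K).indicator fun k => Complex.exp (z * shiftedSymbol d k))

/-- The high-frequency part `|k| > K` of the demodulated semigroup. -/
def highOp (d K : ℝ) (z : ℂ) : L1 →L[ℂ] L1 :=
  mulOp ((Set.Icc (-K) K)ᶜ.indicator fun k => Complex.exp (clamp z * shiftedSymbol d k))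

theorem memLp_indicator_Icc {φ : ℝ → ℂ} (hφ : Continuous φ) (K : ℝ) :
    MemLp ((Set.Icc (-K) K).indicator φ) ∞ volume := by
  obtain ⟨m, hm⟩ := isCompact_Icc.exists_bound_of_continuousOn
    (f := φ) (s := Set.Icc (-K) K) hφ.continuousOn
  refine memLp_top_of_bound (hφ.aestronglyMeasurable.indicator measurableSet_Icc) (max m 0)
    (Eventually.of_forall fun k => ?_)
  by_cases hk : k ∈ Set.Icc (-K) K
  · rw [Set.indicator_of_mem hk]; exact (hm k hk).trans (le_max_left _ _)
  · rw [Set.indicator_of_notMem hk]; simp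

theorem memLp_semigroupOp {d : ℝ} (hd : 0 ≤ d) (z : ℂ) :
    MemLp (fun k => Complex.exp (clamp z * shiftedSymbol d k)) ∞ volume :=
  memLp_top_of_bound (continuous_exp_shiftedSymbol d _).aestronglyMeasurable 1
    (Eventually.of_forall fun k => norm_exp_shiftedSymbol_le_one hd (clamp_mem z) k)

theorem memLp_lowOp (d K : ℝ) (z : ℂ) :
    MemLp ((Set.Icc (-K) K).indicator fun k => Complex.exp (z * shiftedSymbol d k)) ∞ volume :=
  memLp_indicator_Icc (continuous_exp_shiftedSymbol d z) K

theorem memLp_highOp {d : ℝ} (hd : 0 ≤ d) (K : ℝ) (z : ℂ) :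
    MemLp ((Set.Icc (-K) K)ᶜ.indicator fun k => Complex.exp (clamp z * shiftedSymbol d k))
      ∞ volume :=
  (memLp_semigroupOp hd z).indicator measurableSet_Icc.compl

theorem semigroupOp_coeFn {d : ℝ} (hd : 0 ≤ d) (z : ℂ) (f : L1) :
    semigroupOp d z f =ᵐ[volume] fun k => Complex.exp (clamp z * shiftedSymbol d k) * f k :=
  mulOp_coeFn (memLp_semigroupOp hd z) f

theorem lpBound_semigroupOp {d : ℝ} (hd : 0 ≤ d) (z : ℂ) {p : ℝ≥0∞} {f : L1} {c : ℝ}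
    (hf : LpBound p f c) : LpBound p (semigroupOp d z f) c := by
  have := lpBound_mulOp (memLp_semigroupOp hd z) zero_le_one
    (fun k => norm_exp_shiftedSymbol_le_one hd (clamp_mem z) k) hf
  rwa [one_mul] at this

theorem norm_semigroupOp_apply_le {d : ℝ} (hd : 0 ≤ d) (z : ℂ) (f : L1) :
    ‖semigroupOp d z f‖ ≤ ‖f‖ :=
  (lpBound_semigroupOp hd z (lpBound_norm f)).norm_le (norm_nonneg f)

/-- Diffusion has a spectral gap `d K²` on `|k| > K`. The case `K = 1` gives the decay estimates; `K
→ ∞` gives holomorphy by approximation. -/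
theorem lpBound_highOp {d K : ℝ} (hd : 0 ≤ d) (hK : 0 ≤ K) {z : ℂ} (hz : z ∈ quadrant)
    {p : ℝ≥0∞} {f : L1} {c : ℝ} (hf : LpBound p f c) :
    LpBound p (highOp d K z f) (Real.exp (-(z.re * d) * K ^ 2) * c) := by
  refine lpBound_mulOp (memLp_highOp hd K z) (Real.exp_pos _).le (fun k => ?_) hf
  by_cases hk : k ∈ Set.Icc (-K) K
  · rw [Set.indicator_of_notMem (by simpa using hk)]; simpa using (Real.exp_pos _).le
  · rw [Set.indicator_of_mem (by simpa using hk), clamp_of_mem hz]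
    refine (norm_exp_shiftedSymbol_le hz k).trans (Real.exp_le_exp.2 ?_)
    have : K ^ 2 ≤ k ^ 2 := by
      rw [Set.mem_Icc, ← abs_le] at hk
      rw [← sq_abs k]
      exact pow_le_pow_left₀ hK (not_le.1 hk).le 2
    nlinarith [mul_nonneg hz.1 hd]

/-- This is the quantitative non-resonance: in upward imaginary time the low frequencies grow at
rate at most `1/2`, strictly below the rate `1` at which `e^{-is}` decays downwards. -/
theorem sqrt_two_sub_one_le {k : ℝ} (hk : k ∈ Set.Icc (-1 : ℝ) 1) :
    Real.sqrt (1 + k ^ 2) - 1 ≤ 1 / 2 := by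
  have : Real.sqrt (1 + k ^ 2) ≤ 3 / 2 := by
    rw [Real.sqrt_le_left (by norm_num)]
    nlinarith [hk.1, hk.2]
  linarith

theorem norm_exp_low_le {d : ℝ} (z : ℂ) {k : ℝ} (hk : k ∈ Set.Icc (-1 : ℝ) 1) :
    ‖Complex.exp (z * shiftedSymbol d k)‖ ≤
      Real.exp (-(z.re * d) * k ^ 2) * Real.exp (max z.im 0 / 2) := by
  rw [norm_exp_shiftedSymbol, ← Real.exp_add]
  refine Real.exp_le_exp.2 (add_le_add le_rfl ?_)
  have h1 := sqrt_two_sub_one_le hk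
  have h2 := sub_nonneg.2 (one_le_sqrt_one_add_sq k)
  nlinarith [le_max_left z.im 0, le_max_right z.im 0]

theorem lpBound_lowOp_one {d : ℝ} (hd : 0 ≤ d) {z : ℂ} (hz : 0 ≤ z.re)
    {p : ℝ≥0∞} {f : L1} {c : ℝ} (hf : LpBound p f c) :
    LpBound p (lowOp d 1 z f) (Real.exp (max z.im 0 / 2) * c) := by
  refine lpBound_mulOp (memLp_lowOp d 1 z) (Real.exp_pos _).le (fun k => ?_) hf
  by_cases hk : k ∈ Set.Icc (-1 : ℝ) 1
  · rw [Set.indicator_of_mem hk]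
    refine (norm_exp_low_le z hk).trans ?_
    refine mul_le_of_le_one_left (Real.exp_pos _).le (Real.exp_le_one_iff.2 ?_)
    nlinarith [mul_nonneg (mul_nonneg hz hd) (sq_nonneg k)]
  · rw [Set.indicator_of_notMem hk]; simpa using (Real.exp_pos _).le

/-- The constant in the `L^∞ → L¹` decay of the low-frequency semigroup. -/
def gaussConst (d : ℝ) : ℝ := Real.exp d * Real.sqrt (Real.pi / d)

theorem gaussConst_nonneg (d : ℝ) : 0 ≤ gaussConst d := by unfold gaussConst; positivity

/-- The multiplier is dominated by a Gaussian, whose integral gives the rate. On `|k| ≤ 1` the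
exponent `Re z` may be replaced by `1 + Re z` at the price of a factor `e^d`, which removes the
singularity at `Re z = 0`. -/
theorem lpBound_lowOp_gauss {d : ℝ} (hd : 0 < d) {z : ℂ} (hz : 0 ≤ z.re)
    {f : L1} {c : ℝ} (hc : 0 ≤ c) (hf : LpBound ∞ f c) :
    LpBound 1 (lowOp d 1 z f)
      (gaussConst d * (1 + z.re) ^ (-(1 / 2) : ℝ) * (Real.exp (max z.im 0 / 2) * c)) := by
  have h1 : 0 < 1 + z.re := by linarith
  set E := Real.exp (max z.im 0 / 2) with hE
  have hpos : 0 ≤ gaussConst d * (1 + z.re) ^ (-(1 / 2) : ℝ) * (E * c) := by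
    have := gaussConst_nonneg d
    positivity
  rw [lpBound_one_iff hpos, L1.norm_eq_integral_norm]
  have hint := integrable_exp_neg_mul_sq (b := (1 + z.re) * d) (by positivity)
  have hval : ∫ k : ℝ, Real.exp d * (E * c) * Real.exp (-((1 + z.re) * d) * k ^ 2) =
      gaussConst d * (1 + z.re) ^ (-(1 / 2) : ℝ) * (E * c) := by
    rw [integral_const_mul, integral_gaussian, gaussConst, Real.rpow_neg h1.le,
      ← Real.sqrt_eq_rpow, mul_comm (1 + z.re) d, ← div_div, Real.sqrt_div (by positivity)]
    ring
  rw [← hval]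
  refine integral_mono_ae (integrable_L1 _).norm (hint.const_mul _) ?_
  filter_upwards [mulOp_coeFn (memLp_lowOp d 1 z) f, (lpBound_top_iff hc).1 hf] with k hk hk'
  simp only [lowOp, hk, norm_mul]
  by_cases hkm : k ∈ Set.Icc (-1 : ℝ) 1
  · rw [Set.indicator_of_mem hkm]
    have h2 : Real.exp (-(z.re * d) * k ^ 2) ≤
        Real.exp d * Real.exp (-((1 + z.re) * d) * k ^ 2) := by
      rw [← Real.exp_add]
      refine Real.exp_le_exp.2 ?_
      have : k ^ 2 ≤ 1 := by nlinarith [hkm.1, hkm.2]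
      nlinarith
    calc _ ≤ (Real.exp (-(z.re * d) * k ^ 2) * E) * c := by
          gcongr; exact norm_exp_low_le z hkm
      _ ≤ ((Real.exp d * Real.exp (-((1 + z.re) * d) * k ^ 2)) * E) * c := by gcongr
      _ = _ := by ring
  · rw [Set.indicator_of_notMem hkm]
    simp only [norm_zero, zero_mul]
    positivity

theorem semigroupOp_eq_low_add_high {d K : ℝ} (hd : 0 ≤ d) {z : ℂ} (hz : z ∈ quadrant) (f : L1) :
    semigroupOp d z f = lowOp d K z f + highOp d K z f := by
  refine mulOp_add_apply (memLp_lowOp d K z) (memLp_highOp hd K z) (memLp_semigroupOp hd z)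
    (fun k => ?_) f
  rw [clamp_of_mem hz]
  by_cases hk : k ∈ Set.Icc (-K) K
  · rw [Set.indicator_of_mem hk, Set.indicator_of_notMem (by simpa using hk), add_zero]
  · rw [Set.indicator_of_notMem hk, Set.indicator_of_mem (by simpa using hk), zero_add]

/-- The frequency cut-off makes the group law valid for all complex times. This permits paths on
which `z - s` leaves the quadrant, and the splitting of `S(z-s)` into `S(z)` and `S(-s)`. -/
theorem lowOp_add_apply (d K : ℝ) (z w : ℂ) (f : L1) :
    lowOp d K (z + w) f = lowOp d K z (lowOp d K w f) := by
  refine (mulOp_mulOp (memLp_lowOp d K z) (memLp_lowOp d K w) (memLp_lowOp d K (z + w))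
    (fun k => ?_) f).symm
  by_cases hk : k ∈ Set.Icc (-K) K
  · simp only [Set.indicator_of_mem hk, add_mul, Complex.exp_add]
  · simp only [Set.indicator_of_notMem hk, zero_mul]

/-! ### Strong continuity of the semigroup and holomorphy of its truncations -/

theorem continuous_semigroupOp_apply {d : ℝ} (hd : 0 ≤ d) (f : L1) :
    Continuous fun z : ℂ => semigroupOp d z f := by
  rw [continuous_iff_continuousAt]
  intro z₀
  refine tendsto_mulOp (l := 𝓝 z₀) (φ := fun z k => Complex.exp (clamp z * shiftedSymbol d k))
    (m := 1) (fun z => memLp_semigroupOp hd z) (memLp_semigroupOp hd z₀)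
    (fun z k => norm_exp_shiftedSymbol_le_one hd (clamp_mem z) k) (fun k => ?_) f
  have : Continuous fun z : ℂ => Complex.exp (clamp z * shiftedSymbol d k) := by
    have := continuous_clamp
    fun_prop
  exact this.tendsto z₀

/-- Strong continuity in `z` together with the uniform contraction bound suffices; continuity in
operator norm fails at `z = 0`. -/
theorem continuous_semigroupOp {d : ℝ} (hd : 0 ≤ d) :
    Continuous fun p : ℂ × L1 => semigroupOp d p.1 p.2 := by
  rw [continuous_iff_continuousAt]
  rintro ⟨z₀, f₀⟩
  have h1 : Tendsto (fun p : ℂ × L1 => semigroupOp d p.1 f₀) (𝓝 (z₀, f₀))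
      (𝓝 (semigroupOp d z₀ f₀)) :=
    ((continuous_semigroupOp_apply hd f₀).comp continuous_fst).tendsto (z₀, f₀)
  have h2 : Tendsto (fun p : ℂ × L1 => semigroupOp d p.1 (p.2 - f₀)) (𝓝 (z₀, f₀)) (𝓝 0) := by
    refine squeeze_zero_norm (fun p => norm_semigroupOp_apply_le hd p.1 _) ?_
    have h : Continuous fun p : ℂ × L1 => ‖p.2 - f₀‖ :=
      (continuous_snd.sub continuous_const).norm
    have := h.tendsto (z₀, f₀)
    rwa [sub_self, norm_zero] at this
  have h3 := h1.add h2
  rw [add_zero] at h3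
  refine h3.congr fun p => ?_
  rw [map_sub, add_sub_cancel]

theorem norm_mulOp_le {φ : ℝ → ℂ} (h : MemLp φ ∞ volume) {m : ℝ} (hm : 0 ≤ m)
    (hφ : ∀ k, ‖φ k‖ ≤ m) : ‖mulOp φ‖ ≤ m :=
  ContinuousLinearMap.opNorm_le_bound _ hm fun f =>
    (lpBound_mulOp h hm hφ (lpBound_norm f)).norm_le (by positivity)

/-- The symbol is bounded on `|k| ≤ K`, so the second-order Taylor remainder of the exponential is
`O(‖w - z‖²)` uniformly in `k`, hence in operator norm. -/
theorem differentiable_lowOp (d K : ℝ) : Differentiable ℂ (lowOp d K) := by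
  intro z
  obtain ⟨D, hD⟩ := isCompact_Icc.exists_bound_of_continuousOn
    (f := shiftedSymbol d) (s := Set.Icc (-K) K) (continuous_shiftedSymbol d).continuousOn
  obtain ⟨M, hM⟩ := isCompact_Icc.exists_bound_of_continuousOn
    (f := fun k => Complex.exp (z * shiftedSymbol d k)) (s := Set.Icc (-K) K)
    (continuous_exp_shiftedSymbol d z).continuousOn
  have hDer : MemLp ((Set.Icc (-K) K).indicator fun k =>
      shiftedSymbol d k * Complex.exp (z * shiftedSymbol d k)) ∞ volume :=
    memLp_indicator_Icc ((continuous_shiftedSymbol d).mul (continuous_exp_shiftedSymbol d z)) K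
  set A : L1 →L[ℂ] L1 := mulOp ((Set.Icc (-K) K).indicator fun k =>
      shiftedSymbol d k * Complex.exp (z * shiftedSymbol d k)) with hA
  refine HasDerivAt.differentiableAt (f' := A) ?_
  rw [hasDerivAt_iff_isLittleO]
  have hO : (fun w => lowOp d K w - lowOp d K z - (w - z) • A) =O[𝓝 z] fun w => ‖w - z‖ ^ 2 := by
    -- For `K < 0` the interval is empty and its bounds `M`, `D` may be negative, hence the absolute
    -- values.
    refine Asymptotics.IsBigO.of_bound (|M| * |D| ^ 2) ?_
    have hsmall : ∀ᶠ w in 𝓝 z, ‖w - z‖ * |D| < 1 := by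
      have : Continuous fun w : ℂ => ‖w - z‖ * |D| := by fun_prop
      have := this.tendsto z
      simp only [sub_self, norm_zero, zero_mul] at this
      exact this.eventually_lt_const one_pos
    filter_upwards [hsmall] with w hw
    have hmem : MemLp ((Set.Icc (-K) K).indicator fun k =>
        Complex.exp (w * shiftedSymbol d k) - Complex.exp (z * shiftedSymbol d k) -
          (w - z) * (shiftedSymbol d k * Complex.exp (z * shiftedSymbol d k))) ∞ volume :=
      memLp_indicator_Icc (((continuous_exp_shiftedSymbol d w).sub
        (continuous_exp_shiftedSymbol d z)).sub (continuous_const.mul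
        ((continuous_shiftedSymbol d).mul (continuous_exp_shiftedSymbol d z)))) K
    have e : lowOp d K w - lowOp d K z - (w - z) • A = mulOp ((Set.Icc (-K) K).indicator fun k =>
        Complex.exp (w * shiftedSymbol d k) - Complex.exp (z * shiftedSymbol d k) -
          (w - z) * (shiftedSymbol d k * Complex.exp (z * shiftedSymbol d k))) := by
      refine ContinuousLinearMap.ext fun f => Lp.ext ?_
      have := mulOp_coeFn hmem f
      simp only [sub_apply, smul_apply]
      filter_upwards [mulOp_coeFn hmem f, mulOp_coeFn hDer f, mulOp_coeFn (memLp_lowOp d K w) f,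
        mulOp_coeFn (memLp_lowOp d K z) f,
        Lp.coeFn_sub (lowOp d K w f - lowOp d K z f) ((w - z) • A f),
        Lp.coeFn_sub (lowOp d K w f) (lowOp d K z f),
        Lp.coeFn_smul (w - z) (A f)] with k h1 h2 h3 h4 h5 h6 h7
      rw [h5, Pi.sub_apply, h6, Pi.sub_apply, h7, Pi.smul_apply, hA, lowOp, lowOp, h3, h4, h1, h2]
      by_cases hk : k ∈ Set.Icc (-K) K
      · simp only [Set.indicator_of_mem hk, smul_eq_mul]; ring
      · simp only [Set.indicator_of_notMem hk, smul_eq_mul]; ring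
    rw [e]
    refine norm_mulOp_le hmem (by positivity) fun k => ?_
    by_cases hk : k ∈ Set.Icc (-K) K
    · rw [Set.indicator_of_mem hk]
      have hDk : ‖shiftedSymbol d k‖ ≤ |D| := (hD k hk).trans (le_abs_self D)
      have hMk : ‖Complex.exp (z * shiftedSymbol d k)‖ ≤ |M| := (hM k hk).trans (le_abs_self M)
      have hle : ‖(w - z) * shiftedSymbol d k‖ ≤ ‖w - z‖ * |D| := by
        rw [norm_mul]; gcongr
      have e2 : Complex.exp (w * shiftedSymbol d k) - Complex.exp (z * shiftedSymbol d k) -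
          (w - z) * (shiftedSymbol d k * Complex.exp (z * shiftedSymbol d k)) =
          Complex.exp (z * shiftedSymbol d k) * (Complex.exp ((w - z) * shiftedSymbol d k) - 1 -
            (w - z) * shiftedSymbol d k) := by
        have : Complex.exp (w * shiftedSymbol d k) = Complex.exp (z * shiftedSymbol d k) *
            Complex.exp ((w - z) * shiftedSymbol d k) := by
          rw [← Complex.exp_add]; congr 1; ring
        rw [this]; ring
      rw [e2, norm_mul, norm_pow, norm_norm, mul_assoc]
      refine mul_le_mul hMk ?_ (norm_nonneg _) (abs_nonneg M)
      refine (Complex.norm_exp_sub_one_sub_id_le (hle.trans hw.le)).trans ?_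
      calc ‖(w - z) * shiftedSymbol d k‖ ^ 2 ≤ (‖w - z‖ * |D|) ^ 2 := by gcongr
        _ = _ := by ring
    · rw [Set.indicator_of_notMem hk]; simp; positivity
  refine hO.trans_isLittleO ?_
  rw [Asymptotics.isLittleO_iff]
  intro c hc
  filter_upwards [Metric.ball_mem_nhds z hc] with w hw
  rw [norm_pow, norm_norm, pow_two]
  rw [mem_ball_iff_norm] at hw
  gcongr

/-! ### Decay of the semigroup from `L¹ ∩ L^∞` to `L¹` -/

theorem exp_neg_le_rpow {c a : ℝ} (hc : 0 < c) (ha : 0 ≤ a) :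
    Real.exp (-(a * c)) ≤ (1 + 1 / c) * (1 + a) ^ (-(1 / 2) : ℝ) := by
  have h1 : (1 + a) ^ (1 / 2 : ℝ) ≤ 1 + a := by
    conv_rhs => rw [← Real.rpow_one (1 + a)]
    exact Real.rpow_le_rpow_of_exponent_le (by linarith) (by norm_num)
  have h2 : 1 + a ≤ (1 + 1 / c) * Real.exp (a * c) := by
    have h3 := Real.add_one_le_exp (a * c)
    have h4 : (1 + 1 / c) * (a * c + 1) = a * c + 1 + a + 1 / c := by
      field_simp
      ring
    have h5 : (1 + 1 / c) * (a * c + 1) ≤ (1 + 1 / c) * Real.exp (a * c) := by gcongr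
    have : 0 < 1 / c := by positivity
    nlinarith [mul_nonneg ha hc.le]
  rw [Real.rpow_neg (by linarith), Real.exp_neg, ← div_eq_mul_inv, le_div_iff₀ (by positivity),
    inv_mul_le_iff₀ (Real.exp_pos _)]
  linarith

/-- Low frequencies use the Gaussian bound from `L^∞` to `L¹`; high frequencies decay exponentially
in `L¹`. -/
theorem lpBound_semigroupOp_decay {d : ℝ} (hd : 0 < d) {z : ℂ} (hz : z ∈ quadrant)
    {f : L1} {c : ℝ} (hc : 0 ≤ c) (h1 : LpBound 1 f c) (h2 : LpBound ∞ f c) :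
    LpBound 1 (semigroupOp d z f)
      ((gaussConst d + (1 + 1 / d)) * c * (1 + z.re) ^ (-(1 / 2) : ℝ)) := by
  have h0 : 0 < 1 + z.re := by linarith [hz.1]
  rw [semigroupOp_eq_low_add_high (K := 1) hd.le hz]
  have hl := lpBound_lowOp_gauss hd hz.1 hc h2
  rw [max_eq_right hz.2, zero_div, Real.exp_zero, one_mul] at hl
  have hh := lpBound_highOp hd.le zero_le_one hz h1
  have := gaussConst_nonneg d
  refine (hl.add le_rfl hh (by positivity) (by positivity)).mono ?_
  have := exp_neg_le_rpow hd hz.1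
  rw [one_pow, mul_one]
  calc _ ≤ gaussConst d * (1 + z.re) ^ (-(1 / 2) : ℝ) * c +
        ((1 + 1 / d) * (1 + z.re) ^ (-(1 / 2) : ℝ)) * c := by gcongr
    _ = _ := by ring

section

/-! ### The bilinear form on `L¹` -/

/-- The integral `∫ B̂(k,l) f(k-l) g(l) dl`. -/
def bilinFun (B : ℝ × ℝ → ℂ) (f g : ℝ → ℂ) (k : ℝ) : ℂ := ∫ l : ℝ, B (k, l) * f (k - l) * g l

/-- Equality holds at every `k`, not merely almost everywhere, because `l ↦ k - l` preserves null
sets. -/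
theorem bilinFun_congr (B : ℝ × ℝ → ℂ) {f f' g g' : ℝ → ℂ} (hf : f =ᵐ[volume] f')
    (hg : g =ᵐ[volume] g') : bilinFun B f g = bilinFun B f' g' := by
  funext k
  refine integral_congr_ae ?_
  have h := (Measure.measurePreserving_sub_left volume k).quasiMeasurePreserving.ae_eq_comp hf
  filter_upwards [h, hg] with l h1 h2
  simp only [Function.comp_apply] at h1
  rw [h1, h2]

/-- The essential supremum of `|B̂|`. -/
def supNorm (B : ℝ × ℝ → ℂ) : ℝ := (eLpNorm B ∞ volume).toReal

theorem supNorm_nonneg (B : ℝ × ℝ → ℂ) : 0 ≤ supNorm B := ENNReal.toReal_nonneg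

variable {B : ℝ × ℝ → ℂ}

theorem ae_norm_le_supNorm (hB : MemLp B ∞ volume) :
    ∀ᵐ p ∂((volume : Measure ℝ).prod (volume : Measure ℝ)), ‖B p‖ ≤ supNorm B := by
  have hbd := ae_le_eLpNormEssSup (f := B) (μ := volume)
  rw [Measure.volume_eq_prod] at hbd
  filter_upwards [hbd] with p hp
  rw [supNorm, ← toReal_enorm]
  refine ENNReal.toReal_mono hB.2.ne ?_
  rw [eLpNorm_exponent_top]; exact hp

theorem integrable_prod_bilin (hB : MemLp B ∞ volume) {f g : ℝ → ℂ} (hf : Integrable f)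
    (hg : Integrable g) :
    Integrable (fun p : ℝ × ℝ => B p * f (p.1 - p.2) * g p.2)
      ((volume : Measure ℝ).prod (volume : Measure ℝ)) := by
  have h1 : Integrable (fun p : ℝ × ℝ => f (p.1 - p.2) * g p.2)
      ((volume : Measure ℝ).prod (volume : Measure ℝ)) := by
    refine (hg.convolution_integrand (ContinuousLinearMap.mul ℂ ℂ) hf).congr
      (Eventually.of_forall fun p => ?_)
    simp [mul_comm]
  have hm := hB.1
  rw [Measure.volume_eq_prod] at hm
  refine (h1.bdd_mul hm (ae_norm_le_supNorm hB)).congr (Eventually.of_forall fun p => ?_)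
  simp [mul_assoc]

theorem ae_integrable_bilin (hB : MemLp B ∞ volume) {f g : ℝ → ℂ} (hf : Integrable f)
    (hg : Integrable g) :
    ∀ᵐ k : ℝ, Integrable (fun l : ℝ => B (k, l) * f (k - l) * g l) :=
  (integrable_prod_bilin hB hf hg).prod_right_ae

theorem integrable_bilinFun (hB : MemLp B ∞ volume) {f g : ℝ → ℂ} (hf : Integrable f)
    (hg : Integrable g) : Integrable (bilinFun B f g) :=
  (integrable_prod_bilin hB hf hg).integral_prod_left

/-- Once `|B̂|` is replaced by its essential supremum, this is Young's inequality for the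
convolution of `|f|` and `|g|`. -/
theorem integral_norm_bilinFun_le (hB : MemLp B ∞ volume) {f g : ℝ → ℂ} (hf : Integrable f)
    (hg : Integrable g) :
    ∫ k, ‖bilinFun B f g k‖ ≤ supNorm B * (∫ k, ‖f k‖) * ∫ k, ‖g k‖ := by
  have h1 : Integrable (fun p : ℝ × ℝ => ‖g p.2‖ * ‖f (p.1 - p.2)‖)
      ((volume : Measure ℝ).prod (volume : Measure ℝ)) :=
    hg.norm.convolution_integrand (ContinuousLinearMap.mul ℝ ℝ) hf.norm
  have h2 : ∫ k, ∫ l, ‖g l‖ * ‖f (k - l)‖ = (∫ k, ‖g k‖) * ∫ k, ‖f k‖ :=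
    integral_convolution (ContinuousLinearMap.mul ℝ ℝ) hg.norm hf.norm
  have h3 : ∫ k, supNorm B * ∫ l, ‖g l‖ * ‖f (k - l)‖ =
      supNorm B * (∫ k, ‖f k‖) * ∫ k, ‖g k‖ := by
    rw [integral_const_mul, h2]; ring
  rw [← h3]
  refine integral_mono_ae (integrable_bilinFun hB hf hg).norm
    (h1.integral_prod_left.const_mul _) ?_
  filter_upwards [h1.prod_right_ae, Measure.ae_ae_of_ae_prod (ae_norm_le_supNorm hB)] with k hk hk'
  rw [← integral_const_mul]
  refine norm_integral_le_of_norm_le (hk.const_mul _) ?_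
  filter_upwards [hk'] with l hl
  rw [norm_mul, norm_mul, mul_assoc, mul_comm ‖g l‖]
  gcongr

theorem ae_norm_bilinFun_le (hB : MemLp B ∞ volume) {f g : ℝ → ℂ} (hf : Integrable f)
    {c : ℝ} (hg : ∀ᵐ l, ‖g l‖ ≤ c) :
    ∀ᵐ k, ‖bilinFun B f g k‖ ≤ supNorm B * ((∫ l, ‖f l‖) * c) := by
  filter_upwards [Measure.ae_ae_of_ae_prod (ae_norm_le_supNorm hB)] with k hk
  have h1 : ∫ l, supNorm B * (‖f (k - l)‖ * c) = supNorm B * ((∫ l, ‖f l‖) * c) := by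
    rw [integral_const_mul, integral_mul_const,
      integral_sub_left_eq_self (fun l => ‖f l‖) volume k]
  rw [← h1]
  refine norm_integral_le_of_norm_le (((hf.norm.comp_sub_left k).mul_const c).const_mul _) ?_
  filter_upwards [hk, hg] with l h2 h3
  rw [norm_mul, norm_mul, mul_assoc]
  have := supNorm_nonneg B
  gcongr

/-- The bilinear form on the Fourier side, as a continuous bilinear map on `L¹`. -/
def bilinOp (hB : MemLp B ∞ volume) : L1 →L[ℂ] L1 →L[ℂ] L1 :=
  LinearMap.mkContinuous₂
    (LinearMap.mk₂ ℂ
      (fun f g : L1 => (integrable_bilinFun hB (integrable_L1 f) (integrable_L1 g)).toL1 _)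
      (fun f f' g => by
        apply Lp.ext
        filter_upwards [Integrable.coeFn_toL1
            (integrable_bilinFun hB (integrable_L1 (f + f')) (integrable_L1 g)),
          Integrable.coeFn_toL1 (integrable_bilinFun hB (integrable_L1 f) (integrable_L1 g)),
          Integrable.coeFn_toL1 (integrable_bilinFun hB (integrable_L1 f') (integrable_L1 g)),
          Lp.coeFn_add ((integrable_bilinFun hB (integrable_L1 f) (integrable_L1 g)).toL1 _)
            ((integrable_bilinFun hB (integrable_L1 f') (integrable_L1 g)).toL1 _),
          ae_integrable_bilin hB (integrable_L1 f) (integrable_L1 g),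
          ae_integrable_bilin hB (integrable_L1 f') (integrable_L1 g)] with k h1 h2 h3 h4 h5 h6
        rw [h1, h4, Pi.add_apply, h2, h3, bilinFun_congr B (Lp.coeFn_add f f') (ae_eq_refl _)]
        simp only [bilinFun]
        rw [← integral_add h5 h6]
        refine integral_congr_ae (Eventually.of_forall fun l => ?_)
        simp only [Pi.add_apply]; ring)
      (fun c f g => by
        apply Lp.ext
        filter_upwards [Integrable.coeFn_toL1
            (integrable_bilinFun hB (integrable_L1 (c • f)) (integrable_L1 g)),
          Integrable.coeFn_toL1 (integrable_bilinFun hB (integrable_L1 f) (integrable_L1 g)),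
          Lp.coeFn_smul c
            ((integrable_bilinFun hB (integrable_L1 f) (integrable_L1 g)).toL1 _)] with k h1 h2 h4
        rw [h1, h4, Pi.smul_apply, h2, bilinFun_congr B (Lp.coeFn_smul c f) (ae_eq_refl _)]
        simp only [bilinFun, smul_eq_mul]
        rw [← integral_const_mul]
        refine integral_congr_ae (Eventually.of_forall fun l => ?_)
        simp only [Pi.smul_apply, smul_eq_mul]; ring)
      (fun f g g' => by
        apply Lp.ext
        filter_upwards [Integrable.coeFn_toL1
            (integrable_bilinFun hB (integrable_L1 f) (integrable_L1 (g + g'))),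
          Integrable.coeFn_toL1 (integrable_bilinFun hB (integrable_L1 f) (integrable_L1 g)),
          Integrable.coeFn_toL1 (integrable_bilinFun hB (integrable_L1 f) (integrable_L1 g')),
          Lp.coeFn_add ((integrable_bilinFun hB (integrable_L1 f) (integrable_L1 g)).toL1 _)
            ((integrable_bilinFun hB (integrable_L1 f) (integrable_L1 g')).toL1 _),
          ae_integrable_bilin hB (integrable_L1 f) (integrable_L1 g),
          ae_integrable_bilin hB (integrable_L1 f) (integrable_L1 g')] with k h1 h2 h3 h4 h5 h6
        rw [h1, h4, Pi.add_apply, h2, h3, bilinFun_congr B (ae_eq_refl _) (Lp.coeFn_add g g')]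
        simp only [bilinFun]
        rw [← integral_add h5 h6]
        refine integral_congr_ae (Eventually.of_forall fun l => ?_)
        simp only [Pi.add_apply]; ring)
      (fun c f g => by
        apply Lp.ext
        filter_upwards [Integrable.coeFn_toL1
            (integrable_bilinFun hB (integrable_L1 f) (integrable_L1 (c • g))),
          Integrable.coeFn_toL1 (integrable_bilinFun hB (integrable_L1 f) (integrable_L1 g)),
          Lp.coeFn_smul c
            ((integrable_bilinFun hB (integrable_L1 f) (integrable_L1 g)).toL1 _)] with k h1 h2 h4
        rw [h1, h4, Pi.smul_apply, h2, bilinFun_congr B (ae_eq_refl _) (Lp.coeFn_smul c g)]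
        simp only [bilinFun, smul_eq_mul]
        rw [← integral_const_mul]
        refine integral_congr_ae (Eventually.of_forall fun l => ?_)
        simp only [Pi.smul_apply, smul_eq_mul]; ring))
    (supNorm B)
    (fun f g => by
      have h := integral_norm_bilinFun_le hB (integrable_L1 f) (integrable_L1 g)
      rw [LinearMap.mk₂_apply, L1.norm_eq_integral_norm, L1.norm_eq_integral_norm,
        L1.norm_eq_integral_norm]
      refine le_trans (le_of_eq ?_) h
      refine integral_congr_ae ?_
      filter_upwards [Integrable.coeFn_toL1
        (integrable_bilinFun hB (integrable_L1 f) (integrable_L1 g))] with k hk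
      rw [hk])

theorem bilinOp_coeFn (hB : MemLp B ∞ volume) (f g : L1) :
    bilinOp hB f g =ᵐ[volume] bilinFun B f g :=
  Integrable.coeFn_toL1 (integrable_bilinFun hB (integrable_L1 f) (integrable_L1 g))

theorem norm_bilinOp_le (hB : MemLp B ∞ volume) (f g : L1) :
    ‖bilinOp hB f g‖ ≤ supNorm B * ‖f‖ * ‖g‖ := by
  rw [L1.norm_eq_integral_norm, L1.norm_eq_integral_norm, L1.norm_eq_integral_norm]
  refine le_trans (le_of_eq ?_)
    (integral_norm_bilinFun_le hB (integrable_L1 f) (integrable_L1 g))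
  refine integral_congr_ae ?_
  filter_upwards [bilinOp_coeFn hB f g] with k hk
  rw [hk]

theorem lpBound_bilinOp (hB : MemLp B ∞ volume) {f g : L1} {c : ℝ} (hc : 0 ≤ c)
    (hg : LpBound ∞ g c) : LpBound ∞ (bilinOp hB f g) (supNorm B * (‖f‖ * c)) := by
  have := supNorm_nonneg B
  rw [lpBound_top_iff (by positivity), L1.norm_eq_integral_norm]
  filter_upwards [bilinOp_coeFn hB f g,
    ae_norm_bilinFun_le hB (integrable_L1 f) ((lpBound_top_iff hc).1 hg)] with k h1 h2
  rwa [h1]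

end

section

/-! ### Path integrals in the quadrant -/

variable {E : Type*} [NormedAddCommGroup E]

theorem intervalIntegrable_horizontal {h : ℂ → E} (hh : Continuous h) (y x₁ x₂ : ℝ) :
    IntervalIntegrable (fun x : ℝ => h (x + y * Complex.I)) volume x₁ x₂ :=
  Continuous.intervalIntegrable (by fun_prop) _ _

theorem intervalIntegrable_imaginary {h : ℂ → E} (hh : Continuous h) (y₁ y₂ : ℝ) :
    IntervalIntegrable (fun y : ℝ => h (y * Complex.I)) volume y₁ y₂ :=
  Continuous.intervalIntegrable (by fun_prop) _ _

/-- A continuous weight is locally bounded. It may blow up at the boundary of `U`, as it does below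
for `Re z → 0`. -/
theorem tendstoLocallyUniformlyOn_of_norm_le {F : ℕ → ℂ → E} {f : ℂ → E} {U : Set ℂ}
    {m : ℂ → ℝ} {ε : ℕ → ℝ} (hm : ContinuousOn m U) (hε : Tendsto ε atTop (𝓝 0))
    (hε0 : ∀ n, 0 ≤ ε n) (hF : ∀ n, ∀ z ∈ U, ‖f z - F n z‖ ≤ m z * ε n) :
    TendstoLocallyUniformlyOn F f atTop U := by
  rw [Metric.tendstoLocallyUniformlyOn_iff]
  intro δ hδ z hz
  refine ⟨{w ∈ U | m w < m z + 1}, ?_, ?_⟩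
  · filter_upwards [self_mem_nhdsWithin, (hm z hz).eventually_lt_const (lt_add_one (m z))]
      with w h1 h2 using ⟨h1, h2⟩
  · have h1 : Tendsto (fun n => (m z + 1) * ε n) atTop (𝓝 0) := by
      simpa using hε.const_mul (m z + 1)
    filter_upwards [h1.eventually_lt_const hδ] with n hn w hw
    rw [dist_eq_norm]
    refine (hF n w hw.1).trans_lt (lt_of_le_of_lt ?_ hn)
    exact mul_le_mul_of_nonneg_right hw.2.le (hε0 n)

variable [NormedSpace ℂ E]

/-- The integral of `h` from `0` vertically to `i Im z` and then horizontally to `z`. -/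
def pathIntegral (h : ℂ → E) (z : ℂ) : E :=
  (Complex.I • ∫ y in (0 : ℝ)..z.im, h (y * Complex.I)) +
    ∫ x in (0 : ℝ)..z.re, h (x + z.im * Complex.I)

theorem pathIntegral_sub {h h' : ℂ → E} (hh : Continuous h) (hh' : Continuous h') (z : ℂ) :
    pathIntegral (fun s => h s - h' s) z = pathIntegral h z - pathIntegral h' z := by
  simp only [pathIntegral]
  rw [intervalIntegral.integral_sub (intervalIntegrable_imaginary hh _ _)
    (intervalIntegrable_imaginary hh' _ _),
    intervalIntegral.integral_sub (intervalIntegrable_horizontal hh _ _ _)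
    (intervalIntegrable_horizontal hh' _ _ _), smul_sub]
  abel

theorem clm_pathIntegral [CompleteSpace E] (A : E →L[ℂ] E) {h : ℂ → E} (hh : Continuous h)
    (z : ℂ) : A (pathIntegral h z) = pathIntegral (fun s => A (h s)) z := by
  simp only [pathIntegral]
  rw [map_add, map_smul, ContinuousLinearMap.intervalIntegral_comp_comm _
    (intervalIntegrable_imaginary hh _ _), ContinuousLinearMap.intervalIntegral_comp_comm _
    (intervalIntegrable_horizontal hh _ _ _)]

/-- Cauchy's theorem on the rectangle between heights `y₁` and `y₂`, solved for one horizontal side.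
Sides may lie on the boundary of the quadrant, since continuity there and holomorphy inside suffice.
-/
theorem integral_boundary_rect_quadrant {h : ℂ → E} (hh : Continuous h)
    (hd : DifferentiableOn ℂ h openQuadrant) {a y₁ y₂ : ℝ} (ha : 0 ≤ a) (h₁ : y₁ ≤ 0)
    (h₂ : y₂ ≤ 0) :
    (∫ x in (0 : ℝ)..a, h (x + y₁ * Complex.I)) = (∫ x in (0 : ℝ)..a, h (x + y₂ * Complex.I)) -
      (Complex.I • ∫ y in y₁..y₂, h (a + y * Complex.I)) +
      Complex.I • ∫ y in y₁..y₂, h (y * Complex.I) := by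
  have := Complex.integral_boundary_rect_eq_zero_of_continuousOn_of_differentiableOn h
    ⟨0, y₁⟩ ⟨a, y₂⟩ hh.continuousOn (hd.mono fun s hs => by
      rw [Complex.mem_reProdIm] at hs
      obtain ⟨⟨h3, -⟩, -, h4⟩ := hs
      simp only [min_eq_left ha] at h3
      exact ⟨h3, h4.trans_le (max_le h₁ h₂)⟩)
  simp only [Complex.ofReal_zero, zero_add] at this
  rw [sub_eq_zero, sub_add_eq_add_sub, sub_eq_iff_eq_add] at this
  rw [sub_add_eq_add_sub, eq_sub_iff_add_eq, this, add_comm]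

/-- The path is deformed to `0 → -iR → Re z - iR → z`. Its long horizontal side lies at depth `R`,
where `e^{-is}` is exponentially small. -/
theorem pathIntegral_eq_deep {h : ℂ → E} (hh : Continuous h)
    (hd : DifferentiableOn ℂ h openQuadrant) {z : ℂ} (hz : z ∈ quadrant) {R : ℝ} (hR : 0 ≤ R) :
    pathIntegral h z = -(Complex.I • ∫ y in (-R)..(0 : ℝ), h (y * Complex.I)) +
      (∫ x in (0 : ℝ)..z.re, h (x + (-R : ℝ) * Complex.I)) +
      Complex.I • ∫ y in (-R)..z.im, h (z.re + y * Complex.I) := by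
  have e := intervalIntegral.integral_add_adjacent_intervals
    (intervalIntegrable_imaginary hh 0 z.im) (intervalIntegrable_imaginary hh z.im (-R))
  rw [intervalIntegral.integral_symm (-R) 0, ← eq_sub_iff_add_eq] at e
  rw [pathIntegral, integral_boundary_rect_quadrant hh hd hz.1 hz.2 (neg_nonpos.2 hR), e,
    intervalIntegral.integral_symm (-R) z.im, intervalIntegral.integral_symm (-R) z.im]
  simp only [smul_neg, smul_sub]
  abel

/-- By Cauchy's theorem the path integrals to `w` and to `c` differ by the wedge integral from `c`
to `w`, which is a primitive of `h` on a disc around `c`. -/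
theorem hasDerivAt_pathIntegral [CompleteSpace E] {h : ℂ → E} (hh : Continuous h)
    (hd : DifferentiableOn ℂ h openQuadrant) {c : ℂ} (hc : c ∈ openQuadrant) :
    HasDerivAt (pathIntegral h) (h c) c := by
  obtain ⟨r, hr, hball⟩ := Metric.isOpen_iff.1 isOpen_openQuadrant c hc
  have hcons : Complex.IsConservativeOn h (Metric.ball c r) :=
    (hd.mono hball).isConservativeOn
  have h1 := hcons.hasDerivAt_wedgeIntegral hh.continuousOn (Metric.mem_ball_self hr)
  refine (h1.const_add (pathIntegral h c)).congr_of_eventuallyEq ?_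
  filter_upwards [Metric.ball_mem_nhds c hr] with w hw
  have hw' := hball hw
  simp only [pathIntegral, Complex.wedgeIntegral]
  rw [integral_boundary_rect_quadrant hh hd hw'.1.le hw'.2.le hc.2.le,
    ← intervalIntegral.integral_add_adjacent_intervals
      (intervalIntegrable_horizontal hh c.im 0 c.re)
      (intervalIntegrable_horizontal hh c.im c.re w.re),
    ← intervalIntegral.integral_add_adjacent_intervals
      (intervalIntegrable_imaginary hh 0 c.im) (intervalIntegrable_imaginary hh c.im w.im),
    intervalIntegral.integral_symm c.im w.im, intervalIntegral.integral_symm c.im w.im]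
  simp only [smul_neg, smul_add]
  abel

end

section

/-! ### The Duhamel operator in complex time -/

/-- The integrand `e^{-is} S(z-s) q(s)` of the Duhamel integral. -/
def duhamelKernel (d : ℝ) (q : ℂ → L1) (z s : ℂ) : L1 :=
  Complex.exp (-Complex.I * s) • semigroupOp d (z - s) (q s)

/-- The low-frequency part of the Duhamel integrand. -/
def lowKernel (d K : ℝ) (q : ℂ → L1) (z s : ℂ) : L1 :=
  Complex.exp (-Complex.I * s) • lowOp d K (z - s) (q s)

/-- The Duhamel integral `∫₀ᶻ e^{-is} S(z-s) q(s) ds`. -/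
def duhamel (d : ℝ) (q : ℂ → L1) (z : ℂ) : L1 := pathIntegral (duhamelKernel d q z) z

theorem norm_exp_neg_I_mul (s : ℂ) : ‖Complex.exp (-Complex.I * s)‖ = Real.exp s.im := by
  rw [Complex.norm_exp]; simp

variable {d : ℝ} {q : ℂ → L1}

theorem continuous_semigroupOp_comp (hd : 0 ≤ d) {X : Type*} [TopologicalSpace X] {f : X → ℂ}
    {g : X → L1} (hf : Continuous f) (hg : Continuous g) :
    Continuous fun x => semigroupOp d (f x) (g x) :=
  Continuous.comp (g := fun p : ℂ × L1 => semigroupOp d p.1 p.2) (f := fun x => (f x, g x))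
    (continuous_semigroupOp hd) (hf.prodMk hg)

theorem continuous_duhamelKernel (hd : 0 ≤ d) (hq : Continuous q) {X : Type*}
    [TopologicalSpace X] {f g : X → ℂ} (hf : Continuous f) (hg : Continuous g) :
    Continuous fun x => duhamelKernel d q (f x) (g x) := by
  have h1 := continuous_semigroupOp_comp hd (hf.sub hg) (hq.comp hg)
  have h2 : Continuous fun x => Complex.exp (-Complex.I * g x) := by fun_prop
  exact h2.smul h1

theorem continuous_duhamel (hd : 0 ≤ d) (hq : Continuous q) : Continuous (duhamel d q) := by
  have h1 : Continuous (Function.uncurry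
      fun (z : ℂ) (y : ℝ) => duhamelKernel d q z (y * Complex.I)) :=
    continuous_duhamelKernel hd hq continuous_fst (by fun_prop)
  have h2 : Continuous (Function.uncurry
      fun (z : ℂ) (x : ℝ) => duhamelKernel d q z (x + z.im * Complex.I)) :=
    continuous_duhamelKernel hd hq continuous_fst (by fun_prop)
  have h3 := intervalIntegral.continuous_parametric_intervalIntegral_of_continuous
    (a₀ := 0) (μ := volume) h1 Complex.continuous_im
  have h4 := intervalIntegral.continuous_parametric_intervalIntegral_of_continuous
    (a₀ := 0) (μ := volume) h2 Complex.continuous_re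
  exact (h3.const_smul Complex.I).add h4

theorem continuous_lowKernel (K : ℝ) (hq : Continuous q) (z : ℂ) :
    Continuous (lowKernel d K q z) := by
  have h1 : Continuous fun s : ℂ => lowOp d K (z - s) :=
    (differentiable_lowOp d K).continuous.comp (continuous_const.sub continuous_id)
  have h2 : Continuous fun s : ℂ => Complex.exp (-Complex.I * s) := by fun_prop
  exact h2.smul (h1.clm_apply hq)

theorem differentiableOn_lowKernel (K : ℝ) (hq : DifferentiableOn ℂ q openQuadrant) (z : ℂ) :
    DifferentiableOn ℂ (lowKernel d K q z) openQuadrant := by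
  have h1 : Differentiable ℂ fun s : ℂ => lowOp d K (z - s) :=
    (differentiable_lowOp d K).comp (by fun_prop)
  have h2 : Differentiable ℂ fun s : ℂ => Complex.exp (-Complex.I * s) := by fun_prop
  exact h2.differentiableOn.smul (h1.differentiableOn.clm_apply hq)

theorem sub_vertical_mem {z : ℂ} (hz : z ∈ quadrant) {y : ℝ} (hy : y ∈ Set.Icc z.im 0) :
    z - y * Complex.I ∈ quadrant := by
  refine ⟨?_, ?_⟩
  · simpa using hz.1
  · simpa using hy.1

theorem sub_horizontal_mem {z : ℂ} {x : ℝ} (hx : x ∈ Set.Icc 0 z.re) :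
    z - (x + z.im * Complex.I) ∈ quadrant := by
  refine ⟨?_, ?_⟩
  · simpa using hx.2
  · simp

theorem vertical_mem {z : ℂ} {y : ℝ} (hy : y ∈ Set.Icc z.im 0) :
    (y * Complex.I : ℂ) ∈ quadrant := by
  refine ⟨?_, ?_⟩
  · simp
  · simpa using hy.2

theorem horizontal_mem {z : ℂ} (hz : z ∈ quadrant) {x : ℝ} (hx : x ∈ Set.Icc 0 z.re) :
    (x + z.im * Complex.I : ℂ) ∈ quadrant := by
  refine ⟨?_, ?_⟩
  · simpa using hx.1
  · simpa using hz.2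

theorem duhamelKernel_sub_lowKernel (hd : 0 ≤ d) (K : ℝ) {z s : ℂ} (h : z - s ∈ quadrant) :
    duhamelKernel d q z s - lowKernel d K q z s =
      Complex.exp (-Complex.I * s) • highOp d K (z - s) (q s) := by
  rw [duhamelKernel, lowKernel, semigroupOp_eq_low_add_high (K := K) hd h, smul_add,
    add_sub_cancel_left]

theorem duhamel_eq_low_add_high (hd : 0 ≤ d) (hq : Continuous q) (K : ℝ) (z : ℂ) :
    duhamel d q z = pathIntegral (lowKernel d K q z) z +
      pathIntegral (fun s => duhamelKernel d q z s - lowKernel d K q z s) z := by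
  rw [pathIntegral_sub (h := duhamelKernel d q z) (continuous_duhamelKernel hd hq continuous_const continuous_id)
    (continuous_lowKernel K hq z), duhamel, add_sub_cancel]

theorem lowKernel_eq (K : ℝ) (z s : ℂ) :
    lowKernel d K q z s = lowOp d K z (lowKernel d K q 0 s) := by
  rw [lowKernel, lowKernel, map_smul, ← lowOp_add_apply]
  congr 3
  ring

/-- Here `z` enters both the endpoint and the integrand. The group law pulls `lowOp d K z` out of
the integral and leaves a primitive of a kernel independent of `z`. -/
theorem differentiableOn_pathIntegral_lowKernel (K : ℝ) (hq : Continuous q)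
    (hq' : DifferentiableOn ℂ q openQuadrant) :
    DifferentiableOn ℂ (fun z => pathIntegral (lowKernel d K q z) z) openQuadrant := by
  have e : (fun z => pathIntegral (lowKernel d K q z) z) =
      fun z => lowOp d K z (pathIntegral (lowKernel d K q 0) z) := by
    funext z
    rw [clm_pathIntegral _ (continuous_lowKernel K hq 0)]
    congr 1
    funext s
    exact lowKernel_eq K z s
  rw [e]
  refine (differentiable_lowOp d K).differentiableOn.clm_apply fun z hz => ?_
  exact (hasDerivAt_pathIntegral (continuous_lowKernel K hq 0)
    (differentiableOn_lowKernel K hq' 0) hz).differentiableAt.differentiableWithinAt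

theorem lpBound_high_kernel (hd : 0 ≤ d) {K : ℝ} (hK : 0 ≤ K) {p : ℝ≥0∞} {z s : ℂ}
    (h : z - s ∈ quadrant) {c : ℝ} (hc : 0 ≤ c) (hq : LpBound p (q s) c) :
    LpBound p (duhamelKernel d q z s - lowKernel d K q z s)
      (Real.exp s.im * (Real.exp (-((z - s).re * d) * K ^ 2) * c)) := by
  rw [duhamelKernel_sub_lowKernel hd K h]
  exact (lpBound_highOp hd hK h hq).smul_le (norm_exp_neg_I_mul s).le
    (mul_nonneg (Real.exp_pos _).le hc)

/-- The decay `e^{Im s}` beats the growth of the multiplier: for `Im z ≤ 0` the total exponent `Im s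
+ (Im z - Im s)/2` is at most `Im s / 2`. -/
theorem lpBound_low_kernel (hd : 0 ≤ d) {p : ℝ≥0∞} {z s : ℂ} (h : 0 ≤ (z - s).re)
    (hz : z.im ≤ 0) (hs : s.im ≤ 0)
    {c : ℝ} (hc : 0 ≤ c) (hq : LpBound p (q s) c) :
    LpBound p (lowKernel d 1 q z s) (c * Real.exp (s.im / 2)) := by
  refine ((lpBound_lowOp_one hd h hq).smul_le (norm_exp_neg_I_mul s).le
    (mul_nonneg (Real.exp_pos _).le hc)).mono ?_
  rw [mul_comm c, ← mul_assoc, ← Real.exp_add]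
  gcongr
  rcases max_cases (z - s).im 0 with h | h <;> rw [h.1]
  · rw [Complex.sub_im]; linarith
  · linarith

theorem lpBound_low_kernel_gauss (hd : 0 < d) {z s : ℂ} (h : 0 ≤ (z - s).re)
    (hz : z.im ≤ 0) (hs : s.im ≤ 0)
    {c : ℝ} (hc : 0 ≤ c) (hq : LpBound ∞ (q s) c) :
    LpBound 1 (lowKernel d 1 q z s)
      (gaussConst d * (1 + (z - s).re) ^ (-(1 / 2) : ℝ) * c * Real.exp (s.im / 2)) := by
  have h0 : 0 < 1 + (z - s).re := by linarith
  have hg := gaussConst_nonneg d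
  refine ((lpBound_lowOp_gauss hd h hc hq).smul_le (norm_exp_neg_I_mul s).le
    (by positivity)).mono ?_
  have : Real.exp s.im * Real.exp (max (z - s).im 0 / 2) ≤ Real.exp (s.im / 2) := by
    rw [← Real.exp_add, Real.exp_le_exp]
    rcases max_cases (z - s).im 0 with h | h <;> rw [h.1]
    · rw [Complex.sub_im]; linarith
    · linarith
  calc _ = gaussConst d * (1 + (z - s).re) ^ (-(1 / 2) : ℝ) * c *
        (Real.exp s.im * Real.exp (max (z - s).im 0 / 2)) := by ring
    _ ≤ _ := by gcongr

/-! #### Integration of exponential bounds -/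

theorem LpBound.neg {p : ℝ≥0∞} {f : L1} {c : ℝ} (h : LpBound p f c) : LpBound p (-f) c := by
  rw [LpBound, eLpNorm_congr_ae (Lp.coeFn_neg f), eLpNorm_neg]; exact h

theorem LpBound.I_smul {p : ℝ≥0∞} {f : L1} {c : ℝ} (h : LpBound p f c) :
    LpBound p (Complex.I • f) c := by
  have := h.smul Complex.I
  rwa [Complex.norm_I, one_mul] at this

theorem lpBound_integral_exp {p : ℝ≥0∞} (hp : p = 1 ∨ p = ∞) {h : ℝ → L1} (hh : Continuous h)
    {a b m : ℝ} (hab : a ≤ b) (hb : b ≤ 0) (hm : 0 ≤ m)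
    (hbd : ∀ y ∈ Set.Icc a b, LpBound p (h y) (m * Real.exp (y / 2))) :
    LpBound p (∫ y in a..b, h y) (2 * m) := by
  refine (lpBound_intervalIntegral hp hab (hh.intervalIntegrable _ _)
    (Continuous.intervalIntegrable (by fun_prop) _ _) (fun y _ => by positivity) hbd).mono ?_
  have hder : ∀ y ∈ Set.uIcc a b, HasDerivAt (fun y : ℝ => m * (2 * Real.exp (y / 2)))
      (m * Real.exp (y / 2)) y := by
    intro y _
    have := (((hasDerivAt_id y).div_const 2).exp.const_mul 2).const_mul m
    refine this.congr_deriv ?_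
    simp only [id]; ring
  rw [intervalIntegral.integral_eq_sub_of_hasDerivAt hder
    (Continuous.intervalIntegrable (by fun_prop) _ _)]
  have h1 : Real.exp (b / 2) ≤ 1 := Real.exp_le_one_iff.2 (by linarith)
  nlinarith [Real.exp_pos (a / 2), mul_nonneg hm (Real.exp_pos (a / 2)).le]

theorem lpBound_integral_exp_sub {p : ℝ≥0∞} (hp : p = 1 ∨ p = ∞) {h : ℝ → L1} (hh : Continuous h)
    {a c m : ℝ} (ha : 0 ≤ a) (hc : 0 < c) (hm : 0 ≤ m)
    (hbd : ∀ x ∈ Set.Icc 0 a, LpBound p (h x) (m * Real.exp (-((a - x) * c)))) :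
    LpBound p (∫ x in (0 : ℝ)..a, h x) (m / c) := by
  refine (lpBound_intervalIntegral hp ha (hh.intervalIntegrable _ _)
    (Continuous.intervalIntegrable (by fun_prop) _ _) (fun y _ => by positivity) hbd).mono ?_
  have hder : ∀ x ∈ Set.uIcc 0 a, HasDerivAt (fun x : ℝ => m * (Real.exp (-((a - x) * c)) / c))
      (m * Real.exp (-((a - x) * c))) x := by
    intro x _
    have := (((((hasDerivAt_id x).const_sub a).mul_const c).neg.exp).div_const c).const_mul m
    refine this.congr_deriv ?_
    simp only [id, Pi.neg_apply]; field_simp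
  rw [intervalIntegral.integral_eq_sub_of_hasDerivAt hder
    (Continuous.intervalIntegrable (by fun_prop) _ _)]
  have h1 : m * (Real.exp (-((a - a) * c)) / c) = m / c := by simp [div_eq_mul_inv]
  rw [h1]
  have : 0 ≤ m * (Real.exp (-((a - 0) * c)) / c) := by positivity
  linarith

theorem lpBound_integral_const {p : ℝ≥0∞} (hp : p = 1 ∨ p = ∞) {h : ℝ → L1} (hh : Continuous h)
    {a m : ℝ} (ha : 0 ≤ a) (hm : 0 ≤ m) (hbd : ∀ x ∈ Set.Icc 0 a, LpBound p (h x) m) :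
    LpBound p (∫ x in (0 : ℝ)..a, h x) (a * m) := by
  have := lpBound_intervalIntegral hp ha (hh.intervalIntegrable _ _)
    (c := fun _ => m) (Continuous.intervalIntegrable (by fun_prop) _ _) (fun y _ => hm) hbd
  simpa using this

/-! #### Estimates of the Duhamel integral -/

theorem continuous_highKernel (hd : 0 ≤ d) (hq : Continuous q) (K : ℝ) (z : ℂ) :
    Continuous fun s => duhamelKernel d q z s - lowKernel d K q z s :=
  (continuous_duhamelKernel hd hq continuous_const continuous_id).sub
    (continuous_lowKernel K hq z)

/-- The three terms come from the vertical side at `Re s = 0`, the deep horizontal side and the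
vertical side at `Re s = Re z`. The vertical integrals converge uniformly in their length, and the
length `Re z` of the horizontal side is compensated by `e^{-Re z / 2}`. -/
theorem lpBound_low_path {p : ℝ≥0∞} (hp : p = 1 ∨ p = ∞) (hd : 0 < d) (hq : Continuous q)
    (hq' : DifferentiableOn ℂ q openQuadrant) {z : ℂ} (hz : z ∈ quadrant) {m₁ m₂ m₃ : ℝ}
    (hm₁ : 0 ≤ m₁) (hm₂ : 0 ≤ m₂) (hm₃ : 0 ≤ m₃)
    (h₁ : ∀ y : ℝ, y ≤ 0 → LpBound p (lowKernel d 1 q z (y * Complex.I)) (m₁ * Real.exp (y / 2)))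
    (h₂ : ∀ s ∈ quadrant, s.re ≤ z.re → LpBound p (q s) m₂)
    (h₃ : ∀ s ∈ quadrant, s.re = z.re → LpBound p (q s) m₃) :
    LpBound p (pathIntegral (lowKernel d 1 q z) z)
      (2 * m₁ + z.re * Real.exp (-(z.re / 2)) * m₂ + 2 * m₃) := by
  have hp1 : 1 ≤ p := by rcases hp with rfl | rfl <;> simp
  -- The depth `R = Re z - Im z` lies below the endpoint, `-R ≤ Im z`, and gives `e^{-R/2} ≤ e^{-Re
  -- z / 2}` on the horizontal side.
  have hR : 0 ≤ z.re - z.im := by linarith [hz.1, hz.2]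
  have hcont := continuous_lowKernel (d := d) 1 hq z
  rw [pathIntegral_eq_deep hcont (differentiableOn_lowKernel 1 hq' z) hz hR]
  have hre := hz.1
  refine LpBound.add hp1 (LpBound.add hp1 ?_ ?_ (by positivity) (by positivity)) ?_
    (by positivity) (by positivity)
  · refine (lpBound_integral_exp hp (by fun_prop) (by linarith) le_rfl hm₁ fun y hy => ?_).I_smul.neg
    exact h₁ y hy.2
  · rw [mul_assoc]
    refine lpBound_integral_const hp (by fun_prop) hz.1 (by positivity) fun x hx => ?_
    have him : ((x : ℂ) + ((-(z.re - z.im) : ℝ) : ℂ) * Complex.I).im = -(z.re - z.im) := by simp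
    have hre' : ((x : ℂ) + ((-(z.re - z.im) : ℝ) : ℂ) * Complex.I).re = x := by simp
    refine (lpBound_low_kernel hd.le (c := m₂) ?_ hz.2 ?_ hm₂ (h₂ _ ⟨?_, ?_⟩ ?_)).mono ?_
    · rw [Complex.sub_re, hre']; linarith [hx.2]
    · rw [him]; linarith
    · rw [hre']; exact hx.1
    · rw [him]; linarith
    · rw [hre']; exact hx.2
    · rw [him, mul_comm]
      gcongr
      linarith [hz.2]
  · refine (lpBound_integral_exp hp (by fun_prop) (by linarith) hz.2 hm₃ fun y hy => ?_).I_smul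
    have him : ((z.re : ℂ) + y * Complex.I).im = y := by simp
    have hre' : ((z.re : ℂ) + y * Complex.I).re = z.re := by simp
    have hy0 : y ≤ 0 := hy.2.trans hz.2
    have := lpBound_low_kernel (q := q) (z := z) (s := (z.re : ℂ) + y * Complex.I)
      hd.le (p := p) (c := m₃) (by rw [Complex.sub_re, hre', sub_self]) hz.2
      (by rwa [him]) hm₃ (h₃ _ ⟨by rw [hre']; exact hz.1, by rwa [him]⟩ hre')
    rwa [him] at this

/-- The deformed path is useless at high frequency, where `e^{Im(z-s)(⟨k⟩-1)}` grows without bound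
in `k`. The original path keeps `z - s` in the quadrant, and the spectral gap makes the integral
over it bounded. -/
theorem lpBound_high_path {p : ℝ≥0∞} (hp : p = 1 ∨ p = ∞) (hd : 0 < d) (hq : Continuous q)
    {z : ℂ} (hz : z ∈ quadrant) {m₁ m₂ c : ℝ} (hc : 0 < c)
    (hm₁ : 0 ≤ m₁) (hm₂ : 0 ≤ m₂)
    (h₁ : ∀ s ∈ quadrant, LpBound p (q s) m₁)
    (h₂ : ∀ x ∈ Set.Icc 0 z.re, LpBound p (duhamelKernel d q z (x + z.im * Complex.I) -
      lowKernel d 1 q z (x + z.im * Complex.I)) (m₂ * Real.exp (-((z.re - x) * c)))) :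
    LpBound p (pathIntegral (fun s => duhamelKernel d q z s - lowKernel d 1 q z s) z)
      (2 * (Real.exp (-(z.re * d)) * m₁) + m₂ / c) := by
  have hp1 : 1 ≤ p := by rcases hp with rfl | rfl <;> simp
  have hcont := continuous_highKernel hd.le hq 1 z
  set H := fun s => duhamelKernel d q z s - lowKernel d 1 q z s with hH
  rw [pathIntegral]
  refine LpBound.add hp1 ?_ ?_ (by positivity) (by positivity)
  · rw [intervalIntegral.integral_symm]
    refine (lpBound_integral_exp hp (h := fun y : ℝ => H (y * Complex.I)) (by fun_prop) hz.2 le_rfl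
      (by positivity) fun y hy => ?_).neg.I_smul
    refine (lpBound_high_kernel hd.le zero_le_one (sub_vertical_mem hz hy) hm₁
      (h₁ _ (vertical_mem hy))).mono ?_
    have h1 : ((y : ℂ) * Complex.I).im = y := by simp
    have h2 : (z - (y : ℂ) * Complex.I).re = z.re := by simp
    rw [h1, h2, mul_comm]
    have : Real.exp y ≤ Real.exp (y / 2) := Real.exp_le_exp.2 (by linarith [hy.2])
    rw [one_pow, mul_one]
    gcongr
  · exact lpBound_integral_exp_sub hp (h := fun x : ℝ => H (x + z.im * Complex.I))
      (by fun_prop) hz.1 hc hm₂ h₂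

theorem mul_exp_neg_half_le (a : ℝ) : a * Real.exp (-(a / 2)) ≤ 2 := by
  have := Real.add_one_le_exp (a / 2)
  rw [Real.exp_neg, ← div_eq_mul_inv, div_le_iff₀ (Real.exp_pos _)]
  linarith

theorem mul_exp_neg_half_le_rpow {a : ℝ} (ha : 0 ≤ a) :
    a * Real.exp (-(a / 2)) ≤ 20 * (1 + a) ^ (-(1 / 2) : ℝ) := by
  have h1 := Real.add_one_le_exp (a / 4)
  have h2 : a * Real.exp (-(a / 4)) ≤ 4 := by
    rw [Real.exp_neg, ← div_eq_mul_inv, div_le_iff₀ (Real.exp_pos _)]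
    linarith
  have h3 := exp_neg_le_rpow (c := 1 / 4) (by norm_num) ha
  have h4 : Real.exp (-(a / 2)) = Real.exp (-(a / 4)) * Real.exp (-(a * (1 / 4))) := by
    rw [← Real.exp_add]; congr 1; ring
  rw [h4, ← mul_assoc]
  calc _ ≤ 4 * ((1 + 1 / (1 / 4)) * (1 + a) ^ (-(1 / 2) : ℝ)) := by gcongr
    _ = _ := by ring

/-- Half of the exponential pays for moving the weight from `x` to `a`, by `1 + a ≤ (1 + (a - x)) (1
+ x)`; the other half remains for integration in `x`. -/
theorem one_add_rpow_le_mul {d : ℝ} (hd : 0 < d) {a x : ℝ} (hx : 0 ≤ x) (hxa : x ≤ a) :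
    Real.exp (-((a - x) * d)) * (1 + x) ^ (-(1 / 2) : ℝ) ≤
      (1 + 1 / (d / 2)) * (1 + a) ^ (-(1 / 2) : ℝ) * Real.exp (-((a - x) * (d / 2))) := by
  have h1 := exp_neg_le_rpow (c := d / 2) (by positivity) (sub_nonneg.2 hxa)
  have h2 : Real.exp (-((a - x) * d)) = Real.exp (-((a - x) * (d / 2))) *
      Real.exp (-((a - x) * (d / 2))) := by
    rw [← Real.exp_add]; congr 1; ring
  have h3 : (1 + (a - x)) ^ (-(1 / 2) : ℝ) * (1 + x) ^ (-(1 / 2) : ℝ) ≤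
      (1 + a) ^ (-(1 / 2) : ℝ) := by
    rw [← Real.mul_rpow (by linarith) (by linarith)]
    refine Real.rpow_le_rpow_of_nonpos (by linarith) ?_ (by norm_num)
    nlinarith [mul_nonneg hx (sub_nonneg.2 hxa)]
  have hpos : 0 < d / 2 := by positivity
  have hx1 : 0 < 1 + x := by linarith
  calc _ = Real.exp (-((a - x) * (d / 2))) * (Real.exp (-((a - x) * (d / 2))) *
        (1 + x) ^ (-(1 / 2) : ℝ)) := by rw [h2]; ring
    _ ≤ Real.exp (-((a - x) * (d / 2))) * (((1 + 1 / (d / 2)) *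
        (1 + (a - x)) ^ (-(1 / 2) : ℝ)) * (1 + x) ^ (-(1 / 2) : ℝ)) := by gcongr
    _ = Real.exp (-((a - x) * (d / 2))) * ((1 + 1 / (d / 2)) *
        ((1 + (a - x)) ^ (-(1 / 2) : ℝ) * (1 + x) ^ (-(1 / 2) : ℝ))) := by ring
    _ ≤ Real.exp (-((a - x) * (d / 2))) * ((1 + 1 / (d / 2)) *
        (1 + a) ^ (-(1 / 2) : ℝ)) := by gcongr
    _ = _ := by ring

/-- The constant in the estimates of the Duhamel integral. -/
def duhamelConst (d : ℝ) : ℝ :=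
  2 * gaussConst d + 22 + 2 * (1 + 1 / d) + (1 + 1 / (d / 2)) / (d / 2) + 1 / d

theorem duhamelConst_pos (hd : 0 < d) : 0 < duhamelConst d := by
  have := gaussConst_nonneg d
  unfold duhamelConst; positivity

/-- The gain over the direct estimate is that the bound is uniform in `z`, although `q` is only
assumed bounded. It serves the `L^∞` bound (`p = ∞`) and the contraction (`p = 1`). -/
theorem lpBound_duhamel {p : ℝ≥0∞} (hp : p = 1 ∨ p = ∞) (hd : 0 < d) (hq : Continuous q)
    (hq' : DifferentiableOn ℂ q openQuadrant) {m : ℝ} (hm : 0 ≤ m)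
    (h : ∀ s ∈ quadrant, LpBound p (q s) m) {z : ℂ} (hz : z ∈ quadrant) :
    LpBound p (duhamel d q z) (duhamelConst d * m) := by
  have hp1 : 1 ≤ p := by rcases hp with rfl | rfl <;> simp
  rw [duhamel_eq_low_add_high hd.le hq 1]
  have hre := hz.1
  have hg := gaussConst_nonneg d
  have hlow := lpBound_low_path hp hd hq hq' hz (m₁ := m) (m₂ := m) (m₃ := m) hm hm hm
    (fun y hy => by
      have him : ((y : ℂ) * Complex.I).im = y := by simp
      have := lpBound_low_kernel (q := q) (z := z) (s := (y : ℂ) * Complex.I) hd.le (p := p)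
        (c := m) (by simpa using hz.1) hz.2 (by rwa [him]) hm (h _ ⟨by simp, by rwa [him]⟩)
      rwa [him] at this)
    (fun s hs _ => h s hs) (fun s hs _ => h s hs)
  have hhigh := lpBound_high_path hp hd hq hz (m₁ := m) (m₂ := m) hd hm hm h
    (fun x hx => by
      refine (lpBound_high_kernel hd.le zero_le_one (sub_horizontal_mem hx) hm
        (h _ (horizontal_mem hz hx))).mono ?_
      have h1 : ((x : ℂ) + z.im * Complex.I).im = z.im := by simp
      have h2 : (z - ((x : ℂ) + z.im * Complex.I)).re = z.re - x := by simp
      rw [h1, h2, one_pow, mul_one, mul_comm m]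
      exact mul_le_of_le_one_left (by positivity) (Real.exp_le_one_iff.2 hz.2))
  refine (hlow.add hp1 hhigh (by positivity) (by positivity)).mono ?_
  have h1 := mul_exp_neg_half_le z.re
  have h2 : Real.exp (-(z.re * d)) ≤ 1 := Real.exp_le_one_iff.2 (by
    have := mul_nonneg hre hd.le
    linarith)
  calc _ ≤ 2 * m + 2 * m + 2 * m + (2 * (1 * m) + m / d) := by gcongr
    _ = (8 + 1 / d) * m := by ring
    _ ≤ _ := by
      gcongr
      unfold duhamelConst
      have : 0 ≤ 2 * (1 + 1 / d) + (1 + 1 / (d / 2)) / (d / 2) := by positivity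
      linarith

/-- On the side `Re s = 0` the rate comes from Gaussian decay over the elapsed time `Re z`, on the
side `Re s = Re z` from the decay of `q` itself. The deep side and the high frequencies supply
exponential factors. -/
theorem lpBound_duhamel_decay (hd : 0 < d) (hq : Continuous q)
    (hq' : DifferentiableOn ℂ q openQuadrant) {m : ℝ} (hm : 0 ≤ m)
    (h : ∀ s ∈ quadrant, LpBound 1 (q s) (m * (1 + s.re) ^ (-(1 / 2) : ℝ)))
    (h' : ∀ s ∈ quadrant, LpBound ∞ (q s) m) {z : ℂ} (hz : z ∈ quadrant) :
    LpBound 1 (duhamel d q z) (duhamelConst d * m * (1 + z.re) ^ (-(1 / 2) : ℝ)) := by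
  rw [duhamel_eq_low_add_high hd.le hq 1]
  have hre := hz.1
  have hre1 : 0 < 1 + z.re := by linarith
  have hg := gaussConst_nonneg d
  have hle : ∀ s ∈ quadrant, m * (1 + s.re) ^ (-(1 / 2) : ℝ) ≤ m := fun s hs =>
    mul_le_of_le_one_right hm (Real.rpow_le_one_of_one_le_of_nonpos (by linarith [hs.1])
      (by norm_num))
  have hlow := lpBound_low_path (Or.inl rfl) hd hq hq' hz
    (m₁ := gaussConst d * (1 + z.re) ^ (-(1 / 2) : ℝ) * m) (m₂ := m)
    (m₃ := m * (1 + z.re) ^ (-(1 / 2) : ℝ)) (by positivity) hm (by positivity)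
    (fun y hy => by
      have him : ((y : ℂ) * Complex.I).im = y := by simp
      have hre' : (z - (y : ℂ) * Complex.I).re = z.re := by simp
      have := lpBound_low_kernel_gauss (q := q) (z := z) (s := (y : ℂ) * Complex.I) hd
        (c := m) (by simpa using hz.1) hz.2 (by rwa [him]) hm (h' _ ⟨by simp, by rwa [him]⟩)
      rwa [him, hre'] at this)
    (fun s hs _ => (h s hs).mono (hle s hs)) (fun s hs hs' => by rw [← hs']; exact h s hs)
  have hhigh := lpBound_high_path (Or.inl rfl) hd hq hz (m₁ := m)
    (m₂ := m * ((1 + 1 / (d / 2)) * (1 + z.re) ^ (-(1 / 2) : ℝ))) (c := d / 2) (by positivity)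
    hm (by positivity) (fun s hs => (h s hs).mono (hle s hs))
    (fun x hx => by
      have hx1 : 0 < 1 + x := by linarith [hx.1]
      have h1 : ((x : ℂ) + z.im * Complex.I).im = z.im := by simp
      have h2 : (z - ((x : ℂ) + z.im * Complex.I)).re = z.re - x := by simp
      have h3 : ((x : ℂ) + z.im * Complex.I).re = x := by simp
      have h4 := h _ (horizontal_mem hz hx)
      rw [h3] at h4
      refine (lpBound_high_kernel hd.le zero_le_one (sub_horizontal_mem hx) (by positivity)
        h4).mono ?_
      rw [h1, h2, one_pow, mul_one]
      refine (mul_le_of_le_one_left (by positivity) (Real.exp_le_one_iff.2 hz.2)).trans ?_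
      have := one_add_rpow_le_mul hd hx.1 hx.2
      calc _ = m * (Real.exp (-((z.re - x) * d)) * (1 + x) ^ (-(1 / 2) : ℝ)) := by ring
        _ ≤ m * ((1 + 1 / (d / 2)) * (1 + z.re) ^ (-(1 / 2) : ℝ) *
            Real.exp (-((z.re - x) * (d / 2)))) := by gcongr
        _ = _ := by ring)
  refine (hlow.add le_rfl hhigh (by positivity) (by positivity)).mono ?_
  have h1 := mul_exp_neg_half_le_rpow hre
  have h2 := exp_neg_le_rpow hd hre
  calc _ ≤ 2 * (gaussConst d * (1 + z.re) ^ (-(1 / 2) : ℝ) * m) +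
        20 * (1 + z.re) ^ (-(1 / 2) : ℝ) * m + 2 * (m * (1 + z.re) ^ (-(1 / 2) : ℝ)) +
        (2 * ((1 + 1 / d) * (1 + z.re) ^ (-(1 / 2) : ℝ) * m) +
        m * ((1 + 1 / (d / 2)) * (1 + z.re) ^ (-(1 / 2) : ℝ)) / (d / 2)) := by gcongr
    _ = (2 * gaussConst d + 22 + 2 * (1 + 1 / d) + (1 + 1 / (d / 2)) / (d / 2)) * m *
        (1 + z.re) ^ (-(1 / 2) : ℝ) := by ring
    _ ≤ _ := by
      gcongr
      unfold duhamelConst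
      have : 0 < 1 / d := by positivity
      linarith

end

section

variable {d : ℝ} {q : ℂ → L1}

/-! #### Holomorphy -/

theorem exp_neg_le_inv {x : ℝ} (hx : 0 < x) : Real.exp (-x) ≤ x⁻¹ := by
  rw [Real.exp_neg]
  exact inv_anti₀ hx (by linarith [Real.add_one_le_exp x])

theorem tendsto_inv_sq : Tendsto (fun n : ℕ => (((n : ℝ) + 1) ^ 2)⁻¹) atTop (𝓝 0) := by
  have := (tendsto_one_div_add_atTop_nhds_zero_nat (𝕜 := ℝ)).pow 2
  simpa [one_div, inv_pow] using this

theorem exp_neg_mul_sq_le {a d : ℝ} (ha : 0 < a) (hd : 0 < d) (n : ℕ) :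
    Real.exp (-(a * d) * ((n : ℝ) + 1) ^ 2) ≤ (a * d)⁻¹ * (((n : ℝ) + 1) ^ 2)⁻¹ := by
  have := exp_neg_le_inv (x := a * d * ((n : ℝ) + 1) ^ 2) (by positivity)
  rwa [mul_inv, ← neg_mul] at this

/-- The truncations to `|k| ≤ n + 1` are entire, and the remainder `e^{-d Re z (n+1)²}` vanishes
locally uniformly on `Re z > 0`; holomorphy passes to the limit. -/
theorem differentiableOn_semigroupOp (hd : 0 < d) (f : L1) :
    DifferentiableOn ℂ (fun z => semigroupOp d z f) openQuadrant := by
  have hF : TendstoLocallyUniformlyOn (fun (n : ℕ) z => lowOp d ((n : ℝ) + 1) z f)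
      (fun z => semigroupOp d z f) atTop openQuadrant := by
    refine tendstoLocallyUniformlyOn_of_norm_le (m := fun z => ‖f‖ * (z.re * d)⁻¹)
      ?_ tendsto_inv_sq (fun n => by positivity) fun n z hz => ?_
    · refine continuousOn_const.mul (ContinuousOn.inv₀ (by fun_prop) fun z hz => ?_)
      exact (mul_pos hz.1 hd).ne'
    · rw [semigroupOp_eq_low_add_high (K := (n : ℝ) + 1) hd.le (openQuadrant_subset hz),
        add_sub_cancel_left]
      have h1 : 0 < z.re := hz.1
      refine ((lpBound_highOp hd.le (by positivity) (openQuadrant_subset hz)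
        (lpBound_norm f)).norm_le (by positivity)).trans ?_
      have := exp_neg_mul_sq_le hz.1 hd n
      calc _ ≤ (z.re * d)⁻¹ * (((n : ℝ) + 1) ^ 2)⁻¹ * ‖f‖ := by gcongr
        _ = _ := by ring
  refine hF.differentiableOn (Eventually.of_forall fun n => ?_) isOpen_openQuadrant
  exact (differentiable_lowOp d _).differentiableOn.clm_apply (differentiableOn_const f)

/-- On the vertical segment `Re(z - s) = Re z` is positive, so the multiplier itself is small. On
the horizontal segment it is not small near `s = z`, but its integral is of order `1 / (d (n+1)²)`.
-/
theorem norm_high_path_le (hd : 0 < d) (hq : Continuous q) {m : ℝ} (hm : 0 ≤ m)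
    (h : ∀ s ∈ quadrant, LpBound 1 (q s) m) {z : ℂ} (hz : z ∈ openQuadrant) (n : ℕ) :
    ‖pathIntegral (fun s => duhamelKernel d q z s - lowKernel d ((n : ℝ) + 1) q z s) z‖ ≤
      m * ((z.re * d)⁻¹ * |z.im| + d⁻¹) * (((n : ℝ) + 1) ^ 2)⁻¹ := by
  have hz' := openQuadrant_subset hz
  have hre : 0 < z.re := hz.1
  have hcont := continuous_highKernel hd.le hq ((n : ℝ) + 1) z
  set H := fun s => duhamelKernel d q z s - lowKernel d ((n : ℝ) + 1) q z s with hH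
  rw [pathIntegral]
  have h1 : ‖Complex.I • ∫ y in (0 : ℝ)..z.im, H (y * Complex.I)‖ ≤
      m * ((z.re * d)⁻¹ * (((n : ℝ) + 1) ^ 2)⁻¹) * |z.im| := by
    rw [norm_smul, Complex.norm_I, one_mul]
    have := intervalIntegral.norm_integral_le_of_norm_le_const (a := 0) (b := z.im)
      (f := fun y : ℝ => H (y * Complex.I)) (C := m * ((z.re * d)⁻¹ * (((n : ℝ) + 1) ^ 2)⁻¹)) ?_
    · rwa [sub_zero] at this
    intro y hy
    rw [Set.uIoc_of_ge hz.2.le] at hy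
    have hy' := Set.Ioc_subset_Icc_self hy
    refine ((lpBound_high_kernel hd.le (by positivity) (sub_vertical_mem hz' hy') hm
        (h _ (vertical_mem hy'))).norm_le (by positivity)).trans ?_
    have e1 : ((y : ℂ) * Complex.I).im = y := by simp
    have e2 : (z - (y : ℂ) * Complex.I).re = z.re := by simp
    rw [e1, e2]
    have e3 := exp_neg_mul_sq_le hz.1 hd n
    have e4 : Real.exp y ≤ 1 := Real.exp_le_one_iff.2 hy.2
    calc _ ≤ 1 * ((z.re * d)⁻¹ * (((n : ℝ) + 1) ^ 2)⁻¹ * m) := by gcongr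
      _ = _ := by ring
  have h2 : ‖∫ x in (0 : ℝ)..z.re, H (x + z.im * Complex.I)‖ ≤ m / (d * ((n : ℝ) + 1) ^ 2) := by
    refine (lpBound_integral_exp_sub (Or.inl rfl)
      (h := fun x : ℝ => H (x + z.im * Complex.I)) (by fun_prop) hre.le (by positivity) hm
      fun x hx => ?_).norm_le (by positivity)
    refine (lpBound_high_kernel hd.le (by positivity) (sub_horizontal_mem hx) hm
        (h _ (horizontal_mem hz' hx))).mono ?_
    have e1 : ((x : ℂ) + z.im * Complex.I).im = z.im := by simp
    have e2 : (z - ((x : ℂ) + z.im * Complex.I)).re = z.re - x := by simp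
    rw [e1, e2, mul_comm m]
    refine (mul_le_of_le_one_left (by positivity) (Real.exp_le_one_iff.2 hz'.2)).trans ?_
    rw [neg_mul, mul_assoc]
  refine (norm_add_le _ _).trans ((add_le_add h1 h2).trans (le_of_eq ?_))
  field_simp

theorem differentiableOn_duhamel (hd : 0 < d) (hq : Continuous q)
    (hq' : DifferentiableOn ℂ q openQuadrant) {m : ℝ} (hm : 0 ≤ m)
    (h : ∀ s ∈ quadrant, LpBound 1 (q s) m) :
    DifferentiableOn ℂ (duhamel d q) openQuadrant := by
  have hF : TendstoLocallyUniformlyOn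
      (fun (n : ℕ) z => pathIntegral (lowKernel d ((n : ℝ) + 1) q z) z)
      (duhamel d q) atTop openQuadrant := by
    refine tendstoLocallyUniformlyOn_of_norm_le
      (m := fun z => m * ((z.re * d)⁻¹ * |z.im| + d⁻¹))
      ?_ tendsto_inv_sq (fun n => by positivity) fun n z hz => ?_
    · refine continuousOn_const.mul (((ContinuousOn.inv₀ (by fun_prop) fun z hz => ?_).mul
        (by fun_prop)).add continuousOn_const)
      exact (mul_pos hz.1 hd).ne'
    · rw [duhamel_eq_low_add_high hd.le hq ((n : ℝ) + 1), add_sub_cancel_left]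
      exact norm_high_path_le hd hq hm h hz n
  exact hF.differentiableOn (Eventually.of_forall fun n =>
    differentiableOn_pathIntegral_lowKernel _ hq hq') isOpen_openQuadrant

theorem duhamel_sub (hd : 0 ≤ d) {q' : ℂ → L1} (hq : Continuous q) (hq' : Continuous q') (z : ℂ) :
    duhamel d (fun s => q s - q' s) z = duhamel d q z - duhamel d q' z := by
  unfold duhamel
  rw [← pathIntegral_sub (h := duhamelKernel d q z) (h' := duhamelKernel d q' z)
    (continuous_duhamelKernel hd hq continuous_const continuous_id)
    (continuous_duhamelKernel hd hq' continuous_const continuous_id)]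
  congr 1
  funext s
  simp only [duhamelKernel, map_sub, smul_sub]

/-! ### The fixed point argument -/

/-- The complete metric space in which the demodulated solution is constructed. -/
def solutionSpace (r : ℝ) : Set (BoundedContinuousFunction ℂ L1) :=
  {g | DifferentiableOn ℂ g openQuadrant ∧
    (∀ z ∈ quadrant, LpBound 1 (g z) (r * (1 + z.re) ^ (-(1 / 2) : ℝ))) ∧
    (∀ z ∈ quadrant, LpBound ∞ (g z) r) ∧ ∀ z, g z = g (clamp z)}

theorem one_add_re_pos {z : ℂ} (hz : z ∈ quadrant) : 0 < 1 + z.re := by linarith [hz.1]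

/-- Holomorphy survives uniform limits and the norm bounds survive `L¹` limits. Invariance under
`clamp` means that values on the quadrant determine `g`, so the sup distance over `ℂ` sees nothing
else. -/
theorem isClosed_solutionSpace {r : ℝ} (hr : 0 ≤ r) : IsClosed (solutionSpace r) := by
  have hev : ∀ z : ℂ, Continuous fun g : BoundedContinuousFunction ℂ L1 => g z := fun z =>
    (BoundedContinuousFunction.lipschitz_eval_const z).continuous
  have h1 : IsClosed {g : BoundedContinuousFunction ℂ L1 |
      DifferentiableOn ℂ g openQuadrant} := by
    refine IsSeqClosed.isClosed fun u g hu hg => ?_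
    have := BoundedContinuousFunction.tendsto_iff_tendstoUniformly.1 hg
    exact (this.tendstoUniformlyOn.tendstoLocallyUniformlyOn (s := openQuadrant)).differentiableOn
      (Eventually.of_forall hu) isOpen_openQuadrant
  have h2 : IsClosed {g : BoundedContinuousFunction ℂ L1 |
      ∀ z ∈ quadrant, LpBound 1 (g z) (r * (1 + z.re) ^ (-(1 / 2) : ℝ))} := by
    simp only [Set.ofPred_forall]
    refine isClosed_iInter fun z => isClosed_iInter fun hz => ?_
    have := one_add_re_pos hz
    exact (isClosed_lpBound (Or.inl rfl) (by positivity)).preimage (hev z)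
  have h3 : IsClosed {g : BoundedContinuousFunction ℂ L1 |
      ∀ z ∈ quadrant, LpBound ∞ (g z) r} := by
    simp only [Set.ofPred_forall]
    exact isClosed_iInter fun z => isClosed_iInter fun hz =>
      (isClosed_lpBound (Or.inr rfl) hr).preimage (hev z)
  have h4 : IsClosed {g : BoundedContinuousFunction ℂ L1 | ∀ z, g z = g (clamp z)} := by
    simp only [Set.ofPred_forall]
    exact isClosed_iInter fun z => isClosed_eq (hev z) (hev (clamp z))
  exact h1.inter (h2.inter (h3.inter h4))

variable {B : ℝ × ℝ → ℂ}

/-- The nonlinearity `B(g,g)` along `g`. -/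
def bilinAlong (hB : MemLp B ∞ volume) (g : ℂ → L1) (s : ℂ) : L1 := bilinOp hB (g s) (g s)

theorem continuous_bilinAlong (hB : MemLp B ∞ volume) {g : ℂ → L1} (hg : Continuous g) :
    Continuous (bilinAlong hB g) :=
  ((bilinOp hB).continuous.comp hg).clm_apply hg

theorem differentiableOn_bilinAlong (hB : MemLp B ∞ volume) {g : ℂ → L1} {U : Set ℂ}
    (hg : DifferentiableOn ℂ g U) : DifferentiableOn ℂ (bilinAlong hB g) U :=
  ((bilinOp hB).differentiable.comp_differentiableOn hg).clm_apply hg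

theorem rpow_neg_half_le_one {z : ℂ} (hz : z ∈ quadrant) : (1 + z.re) ^ (-(1 / 2) : ℝ) ≤ 1 :=
  Real.rpow_le_one_of_one_le_of_nonpos (by linarith [hz.1]) (by norm_num)

theorem norm_le_of_mem {r : ℝ} (hr : 0 ≤ r) {g : BoundedContinuousFunction ℂ L1}
    (hg : g ∈ solutionSpace r) (z : ℂ) : ‖g z‖ ≤ r := by
  rw [hg.2.2.2 z]
  have := one_add_re_pos (clamp_mem z)
  exact ((hg.2.1 _ (clamp_mem z)).norm_le (by positivity)).trans
    (mul_le_of_le_one_right hr (rpow_neg_half_le_one (clamp_mem z)))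

/-- Only one of the two factors has to contribute its decay; the other is bounded by `r`. -/
theorem lpBound_bilinAlong_one (hB : MemLp B ∞ volume) {r : ℝ} (hr : 0 ≤ r)
    {g : BoundedContinuousFunction ℂ L1} (hg : g ∈ solutionSpace r) {z : ℂ} (hz : z ∈ quadrant) :
    LpBound 1 (bilinAlong hB g z) (supNorm B * r ^ 2 * (1 + z.re) ^ (-(1 / 2) : ℝ)) := by
  have h0 := one_add_re_pos hz
  have hM := supNorm_nonneg B
  refine (lpBound_norm _).mono ((norm_bilinOp_le hB _ _).trans ?_)
  have h1 := norm_le_of_mem hr hg z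
  have h2 := (hg.2.1 z hz).norm_le (by positivity)
  calc _ ≤ supNorm B * r * (r * (1 + z.re) ^ (-(1 / 2) : ℝ)) := by gcongr
    _ = _ := by ring

theorem lpBound_bilinAlong_top (hB : MemLp B ∞ volume) {r : ℝ} (hr : 0 ≤ r)
    {g : BoundedContinuousFunction ℂ L1} (hg : g ∈ solutionSpace r) {z : ℂ} (hz : z ∈ quadrant) :
    LpBound ∞ (bilinAlong hB g z) (supNorm B * r ^ 2) := by
  have hM := supNorm_nonneg B
  refine (lpBound_bilinOp hB hr (hg.2.2.1 z hz)).mono ?_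
  have h1 := norm_le_of_mem hr hg z
  calc _ ≤ supNorm B * (r * r) := by gcongr
    _ = _ := by ring

/-- The constant in the linear and bilinear estimates. -/
def estimateConst (d : ℝ) : ℝ := gaussConst d + (1 + 1 / d) + duhamelConst d

theorem one_le_estimateConst (hd : 0 < d) : 1 ≤ estimateConst d := by
  have h1 := gaussConst_nonneg d
  have h2 := (duhamelConst_pos hd).le
  have h3 : 0 < 1 / d := by positivity
  unfold estimateConst
  linarith

/-- The right-hand side of the demodulated mild formulation. -/
def mildMap (d : ℝ) (hB : MemLp B ∞ volume) (f : L1) (g : ℂ → L1) (z : ℂ) : L1 :=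
  semigroupOp d z f + duhamel d (bilinAlong hB g) (clamp z)

theorem clamp_clamp (z : ℂ) : clamp (clamp z) = clamp z := clamp_of_mem (clamp_mem z)

theorem semigroupOp_clamp (z : ℂ) : semigroupOp d (clamp z) = semigroupOp d z := by
  rw [semigroupOp, clamp_clamp, semigroupOp]

theorem mildMap_clamp (hB : MemLp B ∞ volume) (f : L1) (g : ℂ → L1) (z : ℂ) :
    mildMap d hB f g z = mildMap d hB f g (clamp z) := by
  rw [mildMap, mildMap, semigroupOp_clamp, clamp_clamp]

theorem continuous_mildMap (hd : 0 < d) (hB : MemLp B ∞ volume) (f : L1) {g : ℂ → L1}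
    (hg : Continuous g) : Continuous (mildMap d hB f g) :=
  (continuous_semigroupOp_apply hd.le f).add
    ((continuous_duhamel hd.le (continuous_bilinAlong hB hg)).comp continuous_clamp)

theorem lpBound_mildMap_one (hd : 0 < d) (hB : MemLp B ∞ volume) {r E : ℝ} (hr : 0 ≤ r)
    (hE : 0 ≤ E) {f : L1} (hf1 : LpBound 1 f E) (hf2 : LpBound ∞ f E)
    (hsmall : estimateConst d * (E + supNorm B * r ^ 2) ≤ r)
    {g : BoundedContinuousFunction ℂ L1} (hg : g ∈ solutionSpace r) {z : ℂ} (hz : z ∈ quadrant) :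
    LpBound 1 (mildMap d hB f g z) (r * (1 + z.re) ^ (-(1 / 2) : ℝ)) := by
  have h0 := one_add_re_pos hz
  have hM := supNorm_nonneg B
  have hD := (duhamelConst_pos hd).le
  have hG := gaussConst_nonneg d
  rw [mildMap, clamp_of_mem hz]
  refine ((lpBound_semigroupOp_decay hd hz hE hf1 hf2).add le_rfl
    (lpBound_duhamel_decay hd (continuous_bilinAlong hB g.continuous)
      (differentiableOn_bilinAlong hB hg.1) (m := supNorm B * r ^ 2) (by positivity)
      (fun s hs => lpBound_bilinAlong_one hB hr hg hs)
      (fun s hs => lpBound_bilinAlong_top hB hr hg hs) hz) (by positivity) (by positivity)).mono ?_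
  rw [← add_mul]
  refine mul_le_mul_of_nonneg_right (le_trans ?_ hsmall) (by positivity)
  have h1 : gaussConst d + (1 + 1 / d) ≤ estimateConst d := by unfold estimateConst; linarith
  have h2 : duhamelConst d ≤ estimateConst d := by
    have : 0 < 1 / d := by positivity
    unfold estimateConst; linarith
  calc _ ≤ estimateConst d * E + estimateConst d * (supNorm B * r ^ 2) := by gcongr
    _ = _ := by ring

theorem lpBound_mildMap_top (hd : 0 < d) (hB : MemLp B ∞ volume) {r E : ℝ} (hr : 0 ≤ r)
    (hE : 0 ≤ E) {f : L1} (hf2 : LpBound ∞ f E)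
    (hsmall : estimateConst d * (E + supNorm B * r ^ 2) ≤ r)
    {g : BoundedContinuousFunction ℂ L1} (hg : g ∈ solutionSpace r) {z : ℂ} (hz : z ∈ quadrant) :
    LpBound ∞ (mildMap d hB f g z) r := by
  have h0 := one_add_re_pos hz
  have hM := supNorm_nonneg B
  have hD := (duhamelConst_pos hd).le
  have hG := gaussConst_nonneg d
  rw [mildMap, clamp_of_mem hz]
  refine ((lpBound_semigroupOp hd.le z hf2).add le_top
    (lpBound_duhamel (Or.inr rfl) hd (continuous_bilinAlong hB g.continuous)
      (differentiableOn_bilinAlong hB hg.1) (m := supNorm B * r ^ 2) (by positivity)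
      (fun s hs => lpBound_bilinAlong_top hB hr hg hs) hz) hE (by positivity)).mono ?_
  refine le_trans ?_ hsmall
  have h1 := one_le_estimateConst hd
  have h2 : duhamelConst d ≤ estimateConst d := by
    have : 0 < 1 / d := by positivity
    unfold estimateConst; linarith
  calc _ ≤ estimateConst d * E + estimateConst d * (supNorm B * r ^ 2) := by
        gcongr
        exact le_mul_of_one_le_left hE h1
    _ = _ := by ring

theorem exists_mildMap_mem (hd : 0 < d) (hB : MemLp B ∞ volume) {r E : ℝ} (hr : 0 ≤ r)
    (hE : 0 ≤ E) {f : L1} (hf1 : LpBound 1 f E) (hf2 : LpBound ∞ f E)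
    (hsmall : estimateConst d * (E + supNorm B * r ^ 2) ≤ r)
    {g : BoundedContinuousFunction ℂ L1} (hg : g ∈ solutionSpace r) :
    ∃ g' ∈ solutionSpace r, ∀ z, g' z = mildMap d hB f g z := by
  have hbd : ∀ z, ‖mildMap d hB f g z‖ ≤ r := fun z => by
    rw [mildMap_clamp]
    have := one_add_re_pos (clamp_mem z)
    exact ((lpBound_mildMap_one hd hB hr hE hf1 hf2 hsmall hg (clamp_mem z)).norm_le
      (by positivity)).trans (mul_le_of_le_one_right hr (rpow_neg_half_le_one (clamp_mem z)))
  refine ⟨BoundedContinuousFunction.ofNormedAddCommGroup (mildMap d hB f g)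
    (continuous_mildMap hd hB f g.continuous) r hbd, ⟨?_, ?_, ?_, ?_⟩, fun z => rfl⟩
  · have hM := supNorm_nonneg B
    have h1 := differentiableOn_duhamel hd (continuous_bilinAlong hB g.continuous)
      (differentiableOn_bilinAlong hB hg.1) (m := supNorm B * r ^ 2) (by positivity)
      (fun s hs => (lpBound_bilinAlong_one hB hr hg hs).mono
        (mul_le_of_le_one_right (by positivity) (rpow_neg_half_le_one hs)))
    refine ((differentiableOn_semigroupOp hd f).add h1).congr fun z hz => ?_
    change mildMap d hB f g z = _
    rw [mildMap, clamp_of_mem (openQuadrant_subset hz)]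
    rfl
  · exact fun z hz => lpBound_mildMap_one hd hB hr hE hf1 hf2 hsmall hg hz
  · exact fun z hz => lpBound_mildMap_top hd hB hr hE hf2 hsmall hg hz
  · exact fun z => mildMap_clamp hB f g z

/-- The contraction is measured in the unweighted sup norm with values in `L¹`. The decay and the
`L^∞` bound need not be contracted, being part of the closed set. -/
theorem norm_mildMap_sub_le (hd : 0 < d) (hB : MemLp B ∞ volume) {r : ℝ} (hr : 0 ≤ r)
    (f : L1) {g g' : BoundedContinuousFunction ℂ L1} (hg : g ∈ solutionSpace r)
    (hg' : g' ∈ solutionSpace r) (z : ℂ) :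
    ‖mildMap d hB f g z - mildMap d hB f g' z‖ ≤
      duhamelConst d * (2 * supNorm B * r * dist g g') := by
  have hM := supNorm_nonneg B
  have hD := (duhamelConst_pos hd).le
  have h1 := continuous_bilinAlong hB g.continuous
  have h2 := continuous_bilinAlong hB g'.continuous
  rw [mildMap, mildMap, add_sub_add_left_eq_sub, ← duhamel_sub hd.le h1 h2]
  refine (lpBound_duhamel (Or.inl rfl) hd (h1.sub h2)
    ((differentiableOn_bilinAlong hB hg.1).sub (differentiableOn_bilinAlong hB hg'.1))
    (by positivity) (fun s _ => ?_) (clamp_mem z)).norm_le (by positivity)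
  refine (lpBound_norm _).mono ?_
  have e : bilinAlong hB g s - bilinAlong hB g' s =
      bilinOp hB (g s - g' s) (g s) + bilinOp hB (g' s) (g s - g' s) := by
    simp only [bilinAlong, map_sub, sub_apply]; abel
  rw [Pi.sub_apply, e]
  have h3 : ‖g s - g' s‖ ≤ dist g g' := by
    rw [← dist_eq_norm]; exact BoundedContinuousFunction.dist_coe_le_dist s
  have h4 := norm_le_of_mem hr hg s
  have h5 := norm_le_of_mem hr hg' s
  refine (norm_add_le _ _).trans ((add_le_add (norm_bilinOp_le hB _ _)
    (norm_bilinOp_le hB _ _)).trans ?_)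
  calc _ ≤ supNorm B * dist g g' * r + supNorm B * r * dist g g' := by gcongr
    _ = _ := by ring

/-- Existence of a global solution of the demodulated equation in complex time. -/
theorem exists_demodulated_solution (hd : 0 < d) (hB : MemLp B ∞ volume) {E : ℝ} (hE : 0 ≤ E)
    {f : L1} (hf1 : LpBound 1 f E) (hf2 : LpBound ∞ f E)
    (hsmall : 8 * estimateConst d ^ 2 * supNorm B * E ≤ 1) :
    ∃ g ∈ solutionSpace (2 * estimateConst d * E), ∀ z, g z = mildMap d hB f g z := by
  have hC := one_le_estimateConst hd
  set C := estimateConst d with hCdef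
  have hC0 : 0 < C := by linarith
  have hM := supNorm_nonneg B
  have hr : 0 ≤ 2 * C * E := by positivity
  -- The radius `r = 2CE` is twice the linear contribution `CE`; smallness of `E` bounds the
  -- quadratic contribution by another `CE`. The same condition gives the contraction factor `4 C²
  -- ‖B̂‖ E ≤ 1/2`.
  have hinv : C * (E + supNorm B * (2 * C * E) ^ 2) ≤ 2 * C * E := by
    have h1 : 4 * C ^ 2 * supNorm B * E * E ≤ 1 * E := by
      refine mul_le_mul_of_nonneg_right ?_ hE
      have : 0 ≤ 4 * C ^ 2 * supNorm B * E := by positivity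
      linarith
    calc _ = C * (E + 4 * C ^ 2 * supNorm B * E * E) := by ring
      _ ≤ C * (E + 1 * E) := by gcongr
      _ = _ := by ring
  choose! Φ hΦ hΦ' using fun (g : BoundedContinuousFunction ℂ L1)
    (hg : g ∈ solutionSpace (2 * C * E)) =>
    exists_mildMap_mem hd hB hr hE hf1 hf2 hinv hg
  have hlip : ∀ g ∈ solutionSpace (2 * C * E), ∀ g' ∈ solutionSpace (2 * C * E),
      dist (Φ g) (Φ g') ≤ 1 / 2 * dist g g' := by
    intro g hg g' hg'
    refine (BoundedContinuousFunction.dist_le (by positivity)).2 fun z => ?_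
    rw [dist_eq_norm, hΦ' g hg, hΦ' g' hg']
    refine (norm_mildMap_sub_le hd hB hr f hg hg' z).trans ?_
    have h2 : duhamelConst d ≤ C := by
      have := gaussConst_nonneg d
      have : 0 < 1 / d := by positivity
      rw [hCdef]; unfold estimateConst; linarith
    calc _ ≤ C * (2 * supNorm B * (2 * C * E) * dist g g') := by gcongr
      _ = (8 * C ^ 2 * supNorm B * E) / 2 * dist g g' := by ring
      _ ≤ 1 / 2 * dist g g' := by gcongr
  have hmaps : Set.MapsTo Φ (solutionSpace (2 * C * E)) (solutionSpace (2 * C * E)) := hΦ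
  have hcontr : ContractingWith (1 / 2) (hmaps.restrict Φ _ _) := by
    refine ⟨NNReal.half_lt_self one_ne_zero, LipschitzWith.of_dist_le_mul
      fun g g' => ?_⟩
    exact hlip g g.2 g' g'.2
  have h0 : (0 : BoundedContinuousFunction ℂ L1) ∈ solutionSpace (2 * C * E) :=
    ⟨differentiableOn_const (0 : L1), fun z _ => lpBound_zero 1 _, fun z _ => lpBound_zero ∞ _,
      fun z => rfl⟩
  obtain ⟨g, hg, hfix, -⟩ := hcontr.exists_fixedPoint' (isClosed_solutionSpace hr).isComplete
    hmaps h0 (edist_ne_top _ _)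
  refine ⟨g, hg, fun z => ?_⟩
  rw [← hΦ' g hg, hfix.eq]

end

/-! ### The Fourier transform on `L²` -/

theorem norm_sq_eq_integral (f : L2) : ‖f‖ ^ 2 = ∫ x, ‖f x‖ ^ 2 := by
  have h := inner_self_eq_norm_sq_to_K (𝕜 := ℂ) f
  rw [L2.inner_def] at h
  have h2 : ∫ x, inner ℂ (f x) (f x) = ((∫ x, ‖f x‖ ^ 2 : ℝ) : ℂ) := by
    rw [← integral_complex_ofReal]
    refine integral_congr_ae (Eventually.of_forall fun x => ?_)
    simp only [inner_self_eq_norm_sq_to_K]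
    push_cast; rfl
  rw [h2] at h
  have h3 : ((∫ x, ‖f x‖ ^ 2 : ℝ) : ℂ) = ((‖f‖ ^ 2 : ℝ) : ℂ) := by
    rw [h]; push_cast; rfl
  exact (Complex.ofReal_injective h3).symm

theorem integral_norm_FT_sq (u : L2) : ∫ k, ‖FT u k‖ ^ 2 = 2 * Real.pi * ‖u‖ ^ 2 := by
  have h : ∫ k, ‖FT u k‖ ^ 2 = ∫ k : ℝ, ‖(𝓕 u : L2) ((2 * Real.pi)⁻¹ * k)‖ ^ 2 := by
    refine integral_congr_ae (Eventually.of_forall fun k => ?_)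
    simp only [FT, div_eq_inv_mul]
  rw [h, Measure.integral_comp_mul_left (fun k => ‖(𝓕 u : L2) k‖ ^ 2), ← norm_sq_eq_integral,
    Lp.norm_fourier_eq, inv_inv, abs_of_pos (by positivity), smul_eq_mul]

theorem invFT_congr {g g' : ℝ → ℂ} (h : g =ᵐ[volume] g') : invFT g = invFT g' := by
  have h1 : (fun ξ : ℝ => g (2 * Real.pi * ξ)) =ᵐ[volume] fun ξ => g' (2 * Real.pi * ξ) :=
    (quasi_mul (a := 2 * Real.pi) (by positivity)).ae h
  by_cases hg : MemLp (fun ξ : ℝ => g (2 * Real.pi * ξ)) 2 volume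
  · have hg' := hg.ae_eq h1
    rw [invFT, invFT, dif_pos hg, dif_pos hg', MemLp.toLp_congr hg hg' h1]
  · have hg' : ¬ MemLp (fun ξ : ℝ => g' (2 * Real.pi * ξ)) 2 volume := fun h2 =>
      hg (h2.ae_eq h1.symm)
    rw [invFT, invFT, dif_neg hg, dif_neg hg']

theorem FT_injective {u v : L2} (h : FT u =ᵐ[volume] FT v) : u = v := by
  rw [← invFT_FT u, ← invFT_FT v, invFT_congr h]

theorem ae_comp_div {P : ℝ → Prop} (h : ∀ᵐ x, P x) : ∀ᵐ k : ℝ, P (k / (2 * Real.pi)) := by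
  have := (quasi_mul (a := (2 * Real.pi)⁻¹) (by positivity)).ae h
  simpa only [div_eq_inv_mul] using this

theorem FT_add (u v : L2) : FT (u + v) =ᵐ[volume] fun k => FT u k + FT v k := by
  have h : (𝓕 (u + v) : L2) = 𝓕 u + 𝓕 v := FourierAdd.fourier_add u v
  filter_upwards [ae_comp_div (Lp.coeFn_add (𝓕 u : L2) (𝓕 v))] with k hk
  simp only [FT]
  rw [h, hk]; rfl

theorem FT_smul (c : ℂ) (u : L2) : FT (c • u) =ᵐ[volume] fun k => c * FT u k := by
  have h : (𝓕 (c • u) : L2) = c • 𝓕 u := FourierSMul.fourier_smul c u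
  filter_upwards [ae_comp_div (Lp.coeFn_smul c (𝓕 u : L2))] with k hk
  simp only [FT]
  rw [h, hk]; rfl

theorem FT_sub (u v : L2) : FT (u - v) =ᵐ[volume] fun k => FT u k - FT v k := by
  have h : u - v = u + (-1 : ℂ) • v := by rw [neg_one_smul, sub_eq_add_neg]
  rw [h]
  filter_upwards [FT_add u ((-1 : ℂ) • v), FT_smul (-1) v] with k h1 h2
  rw [h1, h2]; ring

/-- `FT` as a continuous linear map on `L²`. -/
def FTclm : L2 →L[ℂ] L2 :=
  LinearMap.mkContinuous
    { toFun := fun u => (memLp_FT u).toLp (FT u)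
      map_add' := fun u v => by
        rw [← MemLp.toLp_add]
        exact MemLp.toLp_congr _ _ (FT_add u v)
      map_smul' := fun c u => by
        rw [RingHom.id_apply, ← MemLp.toLp_const_smul]
        exact MemLp.toLp_congr _ _ (FT_smul c u) }
    (Real.sqrt (2 * Real.pi)) (fun u => by
      refine le_of_sq_le_sq ?_ (by positivity)
      rw [norm_sq_eq_integral, mul_pow, Real.sq_sqrt (by positivity), ← integral_norm_FT_sq]
      refine le_of_eq (integral_congr_ae ?_)
      filter_upwards [(memLp_FT u).coeFn_toLp] with k hk
      simp only [LinearMap.coe_mk, AddHom.coe_mk, hk])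

theorem FTclm_coeFn (u : L2) : FTclm u =ᵐ[volume] FT u := (memLp_FT u).coeFn_toLp

/-- The functional `u ↦ ∫_A û`. -/
def setIntegralFT {A : Set ℝ} (hA : MeasurableSet A) (hA' : volume A < ∞) : L2 →L[ℂ] ℂ :=
  (innerSL ℂ (indicatorConstLp 2 hA hA'.ne (1 : ℂ))).comp FTclm

theorem setIntegralFT_apply {A : Set ℝ} (hA : MeasurableSet A) (hA' : volume A < ∞) (u : L2) :
    setIntegralFT hA hA' u = ∫ k in A, FT u k := by
  have h : setIntegralFT hA hA' u = inner ℂ (indicatorConstLp 2 hA hA'.ne (1 : ℂ)) (FTclm u) := rfl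
  rw [h, L2.inner_indicatorConstLp_one]
  exact integral_congr_ae (ae_restrict_of_ae (FTclm_coeFn u))

/-- The integrals of `û` over sets of finite measure are continuous on `L²` and separate points; on
`L¹` they are `setIntegralL1`. They thus allow Bochner integrals in the two spaces to be compared.
-/
theorem L2_ext {u v : L2} (h : ∀ (A : Set ℝ) (hA : MeasurableSet A) (hA' : volume A < ∞),
    setIntegralFT hA hA' u = setIntegralFT hA hA' v) : u = v := by
  refine FT_injective ?_
  have h1 := Lp.ae_eq_of_forall_setIntegral_eq (FTclm u) (FTclm v) (by norm_num) (by norm_num)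
    (fun A _ hA' => integrableOn_Lp_of_measure_ne_top _ (by norm_num) hA'.ne)
    (fun A _ hA' => integrableOn_Lp_of_measure_ne_top _ (by norm_num) hA'.ne)
    (fun A hA hA' => by
      have := h A hA hA'
      rw [setIntegralFT_apply, setIntegralFT_apply] at this
      rw [integral_congr_ae (ae_restrict_of_ae (FTclm_coeFn u)),
        integral_congr_ae (ae_restrict_of_ae (FTclm_coeFn v)), this])
  exact (FTclm_coeFn u).symm.trans (h1.trans (FTclm_coeFn v))

theorem norm_invFT_sq {g : ℝ → ℂ} (hg : MemLp g 2 volume) :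
    2 * Real.pi * ‖invFT g‖ ^ 2 = ∫ k, ‖g k‖ ^ 2 := by
  rw [← integral_norm_FT_sq]
  refine integral_congr_ae ?_
  filter_upwards [FT_invFT hg] with k hk
  rw [hk]

theorem invFT_sub {g g' : ℝ → ℂ} (hg : MemLp g 2 volume) (hg' : MemLp g' 2 volume) :
    invFT (fun k => g k - g' k) = invFT g - invFT g' := by
  refine FT_injective ?_
  filter_upwards [FT_sub (invFT g) (invFT g'), FT_invFT hg, FT_invFT hg',
    FT_invFT (hg.sub hg')] with k h1 h2 h3 h4
  rw [h1, h2, h3]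
  exact h4

theorem norm_sq_invFT_le {g : ℝ → ℂ} (hg : MemLp g 2 volume) :
    ‖invFT g‖ ^ 2 ≤ ∫ k, ‖g k‖ ^ 2 := by
  rw [← norm_invFT_sq hg]
  refine le_mul_of_one_le_left (by positivity) ?_
  linarith [Real.pi_gt_three]

/-! ### From `L¹ ∩ L^∞` to `L²` -/

theorem memLp_two_of_lpBound {f : L1} {c : ℝ} (hc : 0 ≤ c) (h : LpBound ∞ f c) :
    MemLp f 2 volume := by
  rw [memLp_two_iff_integrable_sq_norm (Lp.aestronglyMeasurable f)]
  refine ((integrable_L1 f).norm.const_mul c).mono'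
    ((Lp.aestronglyMeasurable f).norm.pow 2) ?_
  filter_upwards [(lpBound_top_iff hc).1 h] with k hk
  rw [norm_pow, norm_norm, pow_two]
  gcongr

/-- Interpolation `‖f‖_{L²}² ≤ ‖f‖_{L^∞} ‖f‖_{L¹}`; the Plancherel factor `1/(2π)` is discarded. -/
theorem norm_sq_invFT_le_of_lpBound {f : L1} {c : ℝ} (hc : 0 ≤ c) (h : LpBound ∞ f c) :
    ‖invFT f‖ ^ 2 ≤ c * ‖f‖ := by
  have h2 := memLp_two_of_lpBound hc h
  refine (norm_sq_invFT_le h2).trans ?_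
  rw [L1.norm_eq_integral_norm, ← integral_const_mul]
  refine integral_mono_ae ((memLp_two_iff_integrable_sq_norm h2.1).1 h2)
    ((integrable_L1 f).norm.const_mul c) ?_
  filter_upwards [(lpBound_top_iff hc).1 h] with k hk
  simp only [pow_two]
  gcongr

theorem invFT_sub_L1 {f f' : L1} (hf : MemLp f 2 volume) (hf' : MemLp f' 2 volume) :
    invFT f - invFT f' = invFT (f - f' : L1) := by
  rw [← invFT_sub hf hf']
  exact invFT_congr (Lp.coeFn_sub f f').symm

theorem continuousOn_invFT {X : Type*} [TopologicalSpace X] {F : X → L1} {s : Set X} {c : ℝ}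
    (hc : 0 ≤ c) (hF : ContinuousOn F s) (hbd : ∀ x ∈ s, LpBound ∞ (F x) c) :
    ContinuousOn (fun x => invFT (F x)) s := by
  intro x hx
  have h1 : Tendsto (fun y => Real.sqrt ((c + c) * ‖F y - F x‖)) (𝓝[s] x) (𝓝 0) := by
    have h2 := tendsto_iff_norm_sub_tendsto_zero.1 (hF x hx)
    have h3 := (h2.const_mul (c + c)).sqrt
    rwa [mul_zero, Real.sqrt_zero] at h3
  refine tendsto_iff_norm_sub_tendsto_zero.2
    (squeeze_zero' (Eventually.of_forall fun y => norm_nonneg _) ?_ h1)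
  filter_upwards [self_mem_nhdsWithin] with y hy
  refine Real.le_sqrt_of_sq_le ?_
  rw [invFT_sub_L1 (memLp_two_of_lpBound hc (hbd y hy)) (memLp_two_of_lpBound hc (hbd x hx))]
  refine norm_sq_invFT_le_of_lpBound (by positivity) ?_
  rw [sub_eq_add_neg]
  exact (hbd y hy).add le_top (hbd x hx).neg hc hc

theorem setIntegralFT_invFT {A : Set ℝ} (hA : MeasurableSet A) (hA' : volume A < ∞) {f : L1}
    (hf : MemLp f 2 volume) : setIntegralFT hA hA' (invFT f) = setIntegralL1 A f := by
  rw [setIntegralFT_apply, setIntegralL1_apply]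
  exact integral_congr_ae (ae_restrict_of_ae (FT_invFT hf))

/-- The Bochner integrals in `L¹` and in `L²` of a curve in `L¹ ∩ L^∞` agree. -/
theorem invFT_intervalIntegral {F : ℝ → L1} {a b c : ℝ} (hab : a ≤ b) (hc : 0 ≤ c)
    (hF : Continuous F) (hbd : ∀ s ∈ Set.Icc a b, LpBound ∞ (F s) c) :
    IntervalIntegrable (fun s => invFT (F s)) volume a b ∧
      invFT (∫ s in a..b, F s : L1) = ∫ s in a..b, invFT (F s) := by
  have hint : IntervalIntegrable (fun s => invFT (F s)) volume a b :=
    ContinuousOn.intervalIntegrable (by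
      rw [Set.uIcc_of_le hab]; exact continuousOn_invFT hc hF.continuousOn hbd)
  refine ⟨hint, L2_ext fun A hA hA' => ?_⟩
  have hbd' := lpBound_intervalIntegral (Or.inr rfl) hab (hF.intervalIntegrable _ _)
    (c := fun _ => c) (Continuous.intervalIntegrable (by fun_prop) _ _) (fun _ _ => hc) hbd
  have hpos : 0 ≤ ∫ _ in a..b, c := intervalIntegral.integral_nonneg hab fun _ _ => hc
  rw [setIntegralFT_invFT hA hA' (memLp_two_of_lpBound hpos hbd'),
    ← ContinuousLinearMap.intervalIntegral_comp_comm _ hint,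
    ← ContinuousLinearMap.intervalIntegral_comp_comm _ (hF.intervalIntegrable _ _)]
  refine intervalIntegral.integral_congr fun s hs => ?_
  rw [Set.uIcc_of_le hab] at hs
  exact (setIntegralFT_invFT hA hA' (memLp_two_of_lpBound hc (hbd s hs))).symm

section

/-! ### The mild solution on the real time axis -/

variable {d : ℝ} {B : ℝ × ℝ → ℂ}

theorem ofReal_mem_quadrant {t : ℝ} (ht : 0 ≤ t) : (t : ℂ) ∈ quadrant := ⟨by simpa, by simp⟩

/-- The Fourier transform `e^{-it} g(t)` of the solution, for a demodulated solution `g`. -/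
def modulate (g : ℂ → L1) (t : ℝ) : L1 := Complex.exp (-Complex.I * t) • g t

theorem norm_exp_neg_I_mul_ofReal (t : ℝ) : ‖Complex.exp (-Complex.I * t)‖ = 1 := by
  rw [norm_exp_neg_I_mul, Complex.ofReal_im, Real.exp_zero]

theorem LpBound.modulate {p : ℝ≥0∞} {g : ℂ → L1} {t c : ℝ} (h : LpBound p (g t) c) :
    LpBound p (modulate g t) c := by
  have := h.smul (Complex.exp (-Complex.I * t))
  rwa [norm_exp_neg_I_mul_ofReal, one_mul] at this

theorem continuous_modulate {g : ℂ → L1} (hg : Continuous g) : Continuous (modulate g) := by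
  have h1 : Continuous fun t : ℝ => Complex.exp (-Complex.I * t) := by fun_prop
  exact h1.smul (hg.comp Complex.continuous_ofReal)

theorem exp_symbol_eq (t k : ℝ) : Complex.exp (t * symbol d k) =
    Complex.exp (-Complex.I * t) * Complex.exp (t * shiftedSymbol d k) := by
  rw [← Complex.exp_add]
  congr 1
  rw [shiftedSymbol]; ring

/-- The semigroup on `L²` is the modulated semigroup on the Fourier side. -/
theorem semigroup_eq (hd : 0 ≤ d) {t : ℝ} (ht : 0 ≤ t) (u : L2) {f : L1}
    (hf : FT u =ᵐ[volume] f) :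
    semigroup d t u = invFT (Complex.exp (-Complex.I * t) • semigroupOp d t f : L1) := by
  refine invFT_congr ?_
  filter_upwards [Lp.coeFn_smul (Complex.exp (-Complex.I * t)) (semigroupOp d t f),
    semigroupOp_coeFn hd t f, hf] with k h1 h2 h3
  rw [h1, Pi.smul_apply, h2, h3, smul_eq_mul, ← mul_assoc,
    clamp_of_mem (ofReal_mem_quadrant ht), ← exp_symbol_eq]

theorem bilinFun_smul (c : ℂ) (f g : ℝ → ℂ) (k : ℝ) :
    bilinFun B (fun l => c * f l) (fun l => c * g l) k = c * c * bilinFun B f g k := by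
  simp only [bilinFun]
  rw [← integral_const_mul]
  refine integral_congr_ae (Eventually.of_forall fun l => ?_)
  simp only; ring

theorem bilinHat_eq (hB : MemLp B ∞ volume) {u : L2} {f : L1} {w : ℂ}
    (hu : FT u =ᵐ[volume] fun k => w * f k) :
    bilinHat B u u =ᵐ[volume] fun k => w * w * bilinOp hB f f k := by
  have h : bilinHat B u u = bilinFun B (fun k => w * f k) (fun k => w * f k) :=
    bilinFun_congr B hu hu
  rw [h]
  filter_upwards [bilinOp_coeFn hB f f] with k hk
  rw [bilinFun_smul, hk]

/-- The phases combine as `e^{-i(t-s)} e^{-2is} = e^{-it} e^{-is}`. The first factor is the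
modulation of the solution; the surplus `e^{-is}` is the oscillation used by the contour argument.
-/
theorem semigroupBilin_eq (hd : 0 ≤ d) (hB : MemLp B ∞ volume) {s t : ℝ} (hst : s ≤ t)
    {g : ℂ → L1} {u : L2} (hu : FT u =ᵐ[volume] modulate g s) :
    semigroupBilin d B (t - s) u u =
      invFT (Complex.exp (-Complex.I * t) • duhamelKernel d (bilinAlong hB g) t s : L1) := by
  refine invFT_congr ?_
  have hu' : FT u =ᵐ[volume] fun k => Complex.exp (-Complex.I * s) * g s k := by
    filter_upwards [hu, Lp.coeFn_smul (Complex.exp (-Complex.I * s)) (g s)] with k h1 h2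
    rw [h1, modulate, h2]; rfl
  have hmem : (t : ℂ) - s ∈ quadrant := by
    have := ofReal_mem_quadrant (sub_nonneg.2 hst)
    rwa [Complex.ofReal_sub] at this
  filter_upwards [bilinHat_eq hB hu',
    Lp.coeFn_smul (Complex.exp (-Complex.I * t)) (duhamelKernel d (bilinAlong hB g) t s),
    Lp.coeFn_smul (Complex.exp (-Complex.I * s)) (semigroupOp d (t - s) (bilinAlong hB g s)),
    semigroupOp_coeFn hd (t - s) (bilinAlong hB g s)] with k h1 h2 h3 h4
  rw [h1, h2, Pi.smul_apply, duhamelKernel, h3, Pi.smul_apply, h4, clamp_of_mem hmem,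
    exp_symbol_eq, bilinAlong, smul_eq_mul, smul_eq_mul]
  have h5 : Complex.exp (-Complex.I * t) =
      Complex.exp (-Complex.I * ((t - s : ℝ) : ℂ)) * Complex.exp (-Complex.I * s) := by
    rw [← Complex.exp_add]; congr 1; push_cast; ring
  rw [h5, Complex.ofReal_sub]
  ring

theorem duhamel_ofReal (d : ℝ) (q : ℂ → L1) (t : ℝ) :
    duhamel d q t = ∫ s in (0 : ℝ)..t, duhamelKernel d q t s := by
  simp only [duhamel, pathIntegral, Complex.ofReal_im, Complex.ofReal_re,
    intervalIntegral.integral_same, smul_zero, zero_add, Complex.ofReal_zero, zero_mul, add_zero]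
  rfl

theorem exists_mildSolution (hd : 0 < d) (hB : MemLp B ∞ volume) {u₀ : L2} {f : L1}
    (hf : FT u₀ =ᵐ[volume] f) {E r : ℝ} (hE : 0 ≤ E) (hr : 0 ≤ r) (hf2 : LpBound ∞ f E)
    {g : BoundedContinuousFunction ℂ L1} (hg : g ∈ solutionSpace r)
    (hfix : ∀ z, g z = mildMap d hB f g z) :
    ∃ u : C(ℝ≥0, L2), IsMildSolution d B u₀ u ∧
      ∀ t : ℝ≥0, u t = invFT (modulate g t) ∧ FT (u t) =ᵐ[volume] modulate g t := by
  have hM := supNorm_nonneg B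
  have hbd : ∀ t : ℝ, 0 ≤ t → LpBound ∞ (modulate g t) r := fun t ht =>
    (hg.2.2.1 t (ofReal_mem_quadrant ht)).modulate
  have hFT : ∀ t : ℝ, 0 ≤ t → FT (invFT (modulate g t)) =ᵐ[volume] modulate g t := fun t ht =>
    FT_invFT (memLp_two_of_lpBound hr (hbd t ht))
  have hcont : Continuous fun t : ℝ≥0 => invFT (modulate g t) := by
    rw [← continuousOn_univ]
    exact continuousOn_invFT (F := fun t : ℝ≥0 => modulate g t) hr
      ((continuous_modulate g.continuous).comp NNReal.continuous_coe).continuousOn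
      fun t _ => hbd t t.2
  refine ⟨⟨_, hcont⟩, fun t => ?_, fun t => ⟨rfl, hFT t t.2⟩⟩
  simp only [ContinuousMap.coe_mk]
  have ht : (0 : ℝ) ≤ t := t.coe_nonneg
  set q := bilinAlong hB g with hq
  have hqc : Continuous q := continuous_bilinAlong hB g.continuous
  set w := Complex.exp (-Complex.I * (t : ℝ)) with hw
  have hw1 : ‖w‖ = 1 := norm_exp_neg_I_mul_ofReal t
  have hker : ∀ s ∈ Set.Icc (0 : ℝ) t,
      semigroupBilin d B (t - s) (invFT (modulate g s.toNNReal)) (invFT (modulate g s.toNNReal)) =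
        invFT (w • duhamelKernel d q t s : L1) := fun s hs => by
    rw [Real.coe_toNNReal s hs.1]
    exact semigroupBilin_eq hd.le hB hs.2 (hFT s hs.1)
  have hkc' : Continuous fun s : ℝ => duhamelKernel d q t s :=
    continuous_duhamelKernel hd.le hqc continuous_const Complex.continuous_ofReal
  have hkc : Continuous fun s : ℝ => w • duhamelKernel d q t s := by fun_prop
  have hkb : ∀ s ∈ Set.Icc (0 : ℝ) t,
      LpBound ∞ (w • duhamelKernel d q t s) (supNorm B * r ^ 2) := fun s hs => by
    have h1 := lpBound_semigroupOp hd.le ((t : ℝ) - s)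
      (lpBound_bilinAlong_top hB hr hg (ofReal_mem_quadrant hs.1))
    have h2 := h1.smul (Complex.exp (-Complex.I * s))
    rw [norm_exp_neg_I_mul_ofReal, one_mul] at h2
    have h3 := h2.smul w
    rwa [hw1, one_mul] at h3
  obtain ⟨hint, hval⟩ := invFT_intervalIntegral ht (mul_nonneg hM (sq_nonneg r)) hkc hkb
  refine ⟨hint.congr fun s hs => ?_, ?_⟩
  · rw [Set.uIoc_of_le ht] at hs
    exact (hker s (Set.Ioc_subset_Icc_self hs)).symm
  · have e1 : ∫ s in (0 : ℝ)..t, semigroupBilin d B (t - s) (invFT (modulate g s.toNNReal))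
        (invFT (modulate g s.toNNReal)) = invFT (w • duhamel d q (t : ℝ) : L1) := by
      rw [duhamel_ofReal, ← intervalIntegral.integral_smul, hval]
      refine intervalIntegral.integral_congr fun s hs => ?_
      rw [Set.uIcc_of_le ht] at hs
      exact hker s hs
    have hmem := memLp_two_of_lpBound (c := E) hE (f := w • semigroupOp d (t : ℝ) f) (by
      have := (lpBound_semigroupOp hd.le ((t : ℝ) : ℂ) hf2).smul w
      rwa [hw1, one_mul] at this)
    have e2 : (modulate g t : L1) - w • semigroupOp d (t : ℝ) f = w • duhamel d q (t : ℝ) := by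
      rw [modulate, hfix, mildMap, clamp_of_mem (ofReal_mem_quadrant ht), smul_add,
        add_sub_cancel_left]
    rw [e1, semigroup_eq hd.le ht u₀ hf, ← e2,
      ← invFT_sub_L1 (memLp_two_of_lpBound hr (hbd t ht)) hmem, add_sub_cancel]

end

section

/-! ### Uniqueness -/

/-- After `τ = t - s` the integral is at most `e^{Lt}` times a Gamma integral over the half-line. -/
theorem integral_rpow_mul_exp_le {L : ℝ} (hL : 0 < L) {t : ℝ} (ht : 0 ≤ t) :
    ∫ s in (0 : ℝ)..t, (t - s) ^ (-(1 / 4) : ℝ) * Real.exp (L * s) ≤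
      Real.exp (L * t) * ((1 / L) ^ (3 / 4 : ℝ) * Real.Gamma (3 / 4)) := by
  have e1 : ∫ s in (0 : ℝ)..t, (t - s) ^ (-(1 / 4) : ℝ) * Real.exp (L * s) =
      ∫ τ in (0 : ℝ)..t, τ ^ (-(1 / 4) : ℝ) * Real.exp (L * (t - τ)) := by
    have := intervalIntegral.integral_comp_sub_left (a := 0) (b := t)
      (fun τ : ℝ => τ ^ (-(1 / 4) : ℝ) * Real.exp (L * (t - τ))) t
    simp only [sub_self, sub_zero, sub_sub_cancel] at this
    exact this
  have e2 : ∀ τ : ℝ, τ ^ (-(1 / 4) : ℝ) * Real.exp (L * (t - τ)) =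
      Real.exp (L * t) * (τ ^ (3 / 4 - 1 : ℝ) * Real.exp (-(L * τ))) := fun τ => by
    have h1 : (3 / 4 - 1 : ℝ) = -(1 / 4) := by norm_num
    have h2 : Real.exp (L * (t - τ)) = Real.exp (L * t) * Real.exp (-(L * τ)) := by
      rw [← Real.exp_add]; congr 1; ring
    rw [h1, h2]; ring
  rw [e1]
  simp only [e2]
  rw [intervalIntegral.integral_const_mul]
  refine mul_le_mul_of_nonneg_left ?_ (Real.exp_pos _).le
  rw [← Real.integral_rpow_mul_exp_neg_mul_Ioi (by norm_num) hL,
    intervalIntegral.integral_of_le ht]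
  refine setIntegral_mono_set ?_ ?_ (Eventually.of_forall Set.Ioc_subset_Ioi_self)
  · have := integrableOn_rpow_mul_exp_neg_mul_rpow (s := (3 / 4 - 1 : ℝ)) (p := 1) (b := L)
      (by norm_num) one_pos hL
    simpa only [Real.rpow_one, neg_mul] using this
  · filter_upwards [ae_restrict_mem measurableSet_Ioi] with τ hτ
    have : 0 < τ := hτ
    simp only [Pi.zero_apply]
    positivity

theorem intervalIntegrable_rpow_sub_mul {φ : ℝ → ℝ} (hφ : Continuous φ) (t : ℝ) :
    IntervalIntegrable (fun s => (t - s) ^ (-(1 / 4) : ℝ) * φ s) volume 0 t := by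
  have h1 : IntervalIntegrable (fun τ : ℝ => τ ^ (-(1 / 4) : ℝ)) volume (t - 0) (t - t) :=
    intervalIntegral.intervalIntegrable_rpow' (by norm_num)
  have h2 := h1.comp_sub_left t
  simp only [sub_sub_cancel] at h2
  exact h2.mul_continuousOn hφ.continuousOn

/-- Grönwall's lemma for the weakly singular kernel `(t-s)^{-1/4}`. -/
theorem eq_zero_of_le_singular_integral {φ : ℝ → ℝ} (hφ : Continuous φ) (hφ0 : ∀ s, 0 ≤ φ s)
    {T A : ℝ} (hT : 0 ≤ T) (hA : 0 ≤ A)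
    (h : ∀ t ∈ Set.Icc 0 T, φ t ≤ A * ∫ s in (0 : ℝ)..t, (t - s) ^ (-(1 / 4) : ℝ) * φ s) :
    ∀ t ∈ Set.Icc 0 T, φ t = 0 := by
  -- The weight `e^{-Ls}` with `L` large makes the integral operator a strict contraction; at the
  -- maximum of `e^{-Ls} φ(s)` this forces the maximum to vanish.
  obtain ⟨L, hL, hLA⟩ : ∃ L : ℝ, 0 < L ∧
      A * ((1 / L) ^ (3 / 4 : ℝ) * Real.Gamma (3 / 4)) < 1 := by
    have h1 : Tendsto (fun L : ℝ => (1 / L) ^ (3 / 4 : ℝ)) atTop (𝓝 0) := by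
      have := (tendsto_rpow_neg_atTop (y := (3 / 4 : ℝ)) (by norm_num))
      refine this.congr' ?_
      filter_upwards [eventually_gt_atTop 0] with L hL
      rw [Real.rpow_neg hL.le, one_div, Real.inv_rpow hL.le]
    have h2 := (h1.mul_const (Real.Gamma (3 / 4))).const_mul A
    rw [zero_mul, mul_zero] at h2
    obtain ⟨L, hL1, hL2⟩ := ((h2.eventually_lt_const one_pos).and (eventually_gt_atTop 0)).exists
    exact ⟨L, hL2, hL1⟩
  have hcont : Continuous fun s => Real.exp (-(L * s)) * φ s := by fun_prop
  obtain ⟨t₀, ht₀, hmax⟩ := isCompact_Icc.exists_isMaxOn (Set.nonempty_Icc.2 hT) hcont.continuousOn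
  set m := Real.exp (-(L * t₀)) * φ t₀ with hm
  have hm0 : 0 ≤ m := mul_nonneg (Real.exp_pos _).le (hφ0 t₀)
  have hle : ∀ s ∈ Set.Icc 0 T, φ s ≤ m * Real.exp (L * s) := fun s hs => by
    have h1 : Real.exp (-(L * s)) * φ s ≤ m := hmax hs
    rw [Real.exp_neg, inv_mul_le_iff₀ (Real.exp_pos _)] at h1
    linarith
  have hint : ∫ s in (0 : ℝ)..t₀, (t₀ - s) ^ (-(1 / 4) : ℝ) * φ s ≤
      m * (Real.exp (L * t₀) * ((1 / L) ^ (3 / 4 : ℝ) * Real.Gamma (3 / 4))) := by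
    have h1 : ∫ s in (0 : ℝ)..t₀, (t₀ - s) ^ (-(1 / 4) : ℝ) * φ s ≤
        ∫ s in (0 : ℝ)..t₀, (t₀ - s) ^ (-(1 / 4) : ℝ) * (m * Real.exp (L * s)) := by
      refine intervalIntegral.integral_mono_on ht₀.1 (intervalIntegrable_rpow_sub_mul hφ t₀)
        (intervalIntegrable_rpow_sub_mul (by fun_prop) t₀) fun s hs => ?_
      exact mul_le_mul_of_nonneg_left (hle s ⟨hs.1, hs.2.trans ht₀.2⟩)
        (Real.rpow_nonneg (by linarith [hs.2]) _)
    refine h1.trans ?_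
    have h2 : ∀ s, (t₀ - s) ^ (-(1 / 4) : ℝ) * (m * Real.exp (L * s)) =
        m * ((t₀ - s) ^ (-(1 / 4) : ℝ) * Real.exp (L * s)) := fun s => by ring
    simp only [h2]
    rw [intervalIntegral.integral_const_mul]
    exact mul_le_mul_of_nonneg_left (integral_rpow_mul_exp_le hL ht₀.1) hm0
  have hmle : m ≤ A * ((1 / L) ^ (3 / 4 : ℝ) * Real.Gamma (3 / 4)) * m := by
    have h1 := (h t₀ ht₀).trans (mul_le_mul_of_nonneg_left hint hA)
    rw [hm, Real.exp_neg, inv_mul_le_iff₀ (Real.exp_pos _)]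
    have h2 : (Real.exp (L * t₀))⁻¹ * φ t₀ = m := by rw [hm, Real.exp_neg]
    rw [h2]
    linarith
  have hmz : m = 0 := by nlinarith
  intro t ht
  have := hle t ht
  rw [hmz, zero_mul] at this
  exact le_antisymm this (hφ0 t)

variable {d : ℝ} {B : ℝ × ℝ → ℂ}

theorem sqrt_integral_norm_FT_sq (u : L2) :
    (∫ k, ‖FT u k‖ ^ 2) ^ (1 / 2 : ℝ) = Real.sqrt (2 * Real.pi) * ‖u‖ := by
  rw [integral_norm_FT_sq, ← Real.sqrt_eq_rpow, Real.sqrt_mul (by positivity),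
    Real.sqrt_sq (norm_nonneg u)]

theorem integral_norm_FT_mul_le (u v : L2) (k : ℝ) :
    Integrable (fun l => ‖FT u (k - l)‖ * ‖FT v l‖) ∧
      ∫ l, ‖FT u (k - l)‖ * ‖FT v l‖ ≤ 2 * Real.pi * (‖u‖ * ‖v‖) := by
  have h1 : MemLp (fun l => FT u (k - l)) 2 volume :=
    (memLp_FT u).comp_measurePreserving (Measure.measurePreserving_sub_left volume k)
  refine ⟨memLp_one_iff_integrable.1 ((memLp_FT v).norm.mul h1.norm), ?_⟩
  have h2 := integral_mul_norm_le_Lp_mul_Lq (f := fun l => FT u (k - l)) (g := FT v)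
    (μ := volume) Real.HolderConjugate.two_two (by simpa using h1) (by simpa using memLp_FT v)
  simp only [Real.rpow_two] at h2
  rw [integral_sub_left_eq_self (fun l => ‖FT u l‖ ^ 2) volume k, sqrt_integral_norm_FT_sq,
    sqrt_integral_norm_FT_sq] at h2
  refine h2.trans (le_of_eq ?_)
  have := Real.mul_self_sqrt (show 0 ≤ 2 * Real.pi by positivity)
  linear_combination (‖u‖ * ‖v‖) * this

theorem ae_norm_bilinHat_sub_le (hB : MemLp B ∞ volume) (u v : L2) :
    ∀ᵐ k, ‖bilinHat B u u k - bilinHat B v v k‖ ≤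
      supNorm B * (2 * Real.pi) * ((‖u‖ + ‖v‖) * ‖u - v‖) := by
  filter_upwards [integrable_bilin hB u u, integrable_bilin hB v v,
    Measure.ae_ae_of_ae_prod (ae_norm_le_supNorm hB)] with k h1 h2 h3
  obtain ⟨i1, b1⟩ := integral_norm_FT_mul_le (u - v) u k
  obtain ⟨i2, b2⟩ := integral_norm_FT_mul_le v (u - v) k
  have hM := supNorm_nonneg B
  simp only [bilinHat]
  rw [← integral_sub h1 h2]
  have hle : ∫ l, supNorm B * (‖FT (u - v) (k - l)‖ * ‖FT u l‖ + ‖FT v (k - l)‖ * ‖FT (u - v) l‖) ≤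
      supNorm B * (2 * Real.pi) * ((‖u‖ + ‖v‖) * ‖u - v‖) := by
    rw [integral_const_mul, integral_add i1 i2]
    calc _ ≤ supNorm B * (2 * Real.pi * (‖u - v‖ * ‖u‖) + 2 * Real.pi * (‖v‖ * ‖u - v‖)) := by
          gcongr
      _ = _ := by ring
  refine le_trans (norm_integral_le_of_norm_le ((i1.add i2).const_mul _) ?_) hle
  have h4 := (Measure.measurePreserving_sub_left volume k).quasiMeasurePreserving.ae (FT_sub u v)
  filter_upwards [h3, FT_sub u v, h4] with l hl h5 h6
  have e : B (k, l) * FT u (k - l) * FT u l - B (k, l) * FT v (k - l) * FT v l =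
      B (k, l) * (FT (u - v) (k - l) * FT u l + FT v (k - l) * FT (u - v) l) := by
    rw [h5, h6]; ring
  rw [e, norm_mul]
  simp only [Pi.add_apply]
  gcongr
  refine (norm_add_le _ _).trans ?_
  rw [norm_mul, norm_mul]

/-- The constant in the smoothing estimate of the bilinear form. -/
def smoothingConst (d : ℝ) : ℝ := Real.sqrt (Real.sqrt (Real.pi / (2 * d)))

/-- The `L²` norm of `e^{-τ d k²}` is `(π / (2dτ))^{1/4}`. The singularity at `τ = 0` is integrable,
so uniqueness needs neither smallness nor integrability of `û`. -/
theorem norm_invFT_exp_mul_le (hd : 0 < d) {τ : ℝ} (hτ : 0 < τ) {h : ℝ → ℂ} {c : ℝ} (hc : 0 ≤ c)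
    (hm : MemLp (fun k => Complex.exp (τ * symbol d k) * h k) 2 volume)
    (hh : ∀ᵐ k, ‖h k‖ ≤ c) :
    ‖invFT (fun k => Complex.exp (τ * symbol d k) * h k)‖ ≤
      smoothingConst d * τ ^ (-(1 / 4) : ℝ) * c := by
  have hpos : 0 ≤ smoothingConst d := Real.sqrt_nonneg _
  refine le_of_sq_le_sq ?_ (by positivity)
  refine (norm_sq_invFT_le hm).trans ?_
  have hint := integrable_exp_neg_mul_sq (b := 2 * d * τ) (by positivity)
  have hval : ∫ k : ℝ, c ^ 2 * Real.exp (-(2 * d * τ) * k ^ 2) =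
      (smoothingConst d * τ ^ (-(1 / 4) : ℝ) * c) ^ 2 := by
    rw [integral_const_mul, integral_gaussian, mul_pow, mul_pow, smoothingConst,
      Real.sq_sqrt (Real.sqrt_nonneg _), ← Real.rpow_mul_natCast hτ.le, ← div_div,
      Real.sqrt_div (by positivity), Real.sqrt_eq_rpow τ]
    have : (-(1 / 4) * (2 : ℕ) : ℝ) = -(1 / 2) := by norm_num
    rw [this, Real.rpow_neg hτ.le]
    ring
  rw [← hval]
  refine integral_mono_ae ((memLp_two_iff_integrable_sq_norm hm.1).1 hm) (hint.const_mul _) ?_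
  filter_upwards [hh] with k hk
  rw [norm_mul, norm_exp_symbol, mul_pow, ← Real.exp_nat_mul, mul_comm]
  have e : ((2 : ℕ) : ℝ) * (-(τ * d) * k ^ 2) = -(2 * d * τ) * k ^ 2 := by push_cast; ring
  rw [e]
  gcongr

theorem norm_semigroupBilin_sub_le (hd : 0 < d) (hB : MemLp B ∞ volume) {τ : ℝ} (hτ : 0 < τ)
    (u v : L2) :
    ‖semigroupBilin d B τ u u - semigroupBilin d B τ v v‖ ≤
      smoothingConst d * τ ^ (-(1 / 4) : ℝ) *
        (supNorm B * (2 * Real.pi) * ((‖u‖ + ‖v‖) * ‖u - v‖)) := by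
  have h1 := memLp_semigroupBilin hd hτ hB u u
  have h2 := memLp_semigroupBilin hd hτ hB v v
  have hM := supNorm_nonneg B
  rw [semigroupBilin, semigroupBilin, ← invFT_sub h1 h2]
  have e : (fun k => Complex.exp (τ * symbol d k) * bilinHat B u u k -
      Complex.exp (τ * symbol d k) * bilinHat B v v k) =
      fun k => Complex.exp (τ * symbol d k) * (bilinHat B u u k - bilinHat B v v k) := by
    funext k; ring
  have h3 := h1.sub h2
  have h4 : MemLp (fun k => Complex.exp (τ * symbol d k) *
      (bilinHat B u u k - bilinHat B v v k)) 2 volume := by rw [← e]; exact h3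
  rw [e]
  exact norm_invFT_exp_mul_le hd hτ (by positivity) h4 (ae_norm_bilinHat_sub_le hB u v)

theorem mildSolution_unique (hd : 0 < d) (hB : MemLp B ∞ volume) {u₀ : L2} {u v : C(ℝ≥0, L2)}
    (hu : IsMildSolution d B u₀ u) (hv : IsMildSolution d B u₀ v) : u = v := by
  have hM := supNorm_nonneg B
  have hcont : ∀ w : C(ℝ≥0, L2), Continuous fun s : ℝ => w s.toNNReal := fun w =>
    w.continuous.comp continuous_real_toNNReal
  ext1 T
  obtain ⟨R, hR⟩ := isCompact_Icc.exists_bound_of_continuousOn (s := Set.Icc (0 : ℝ) T)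
    ((hcont u).norm.add (hcont v).norm).continuousOn
  have hR0 : 0 ≤ R := (norm_nonneg _).trans (hR 0 ⟨le_rfl, T.coe_nonneg⟩)
  set φ : ℝ → ℝ := fun s => ‖u s.toNNReal - v s.toNNReal‖ with hφ
  have hφc : Continuous φ := ((hcont u).sub (hcont v)).norm
  set A := smoothingConst d * (supNorm B * (2 * Real.pi) * R) with hA
  have hA0 : 0 ≤ A := by
    have : 0 ≤ smoothingConst d := Real.sqrt_nonneg _
    positivity
  have key : ∀ t ∈ Set.Icc (0 : ℝ) T,
      φ t ≤ A * ∫ s in (0 : ℝ)..t, (t - s) ^ (-(1 / 4) : ℝ) * φ s := by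
    intro t ht
    obtain ⟨iu, eu⟩ := hu t.toNNReal
    obtain ⟨iv, ev⟩ := hv t.toNNReal
    rw [Real.coe_toNNReal t ht.1] at iu eu iv ev
    simp only [hφ]
    rw [eu, ev, add_sub_add_left_eq_sub, ← intervalIntegral.integral_sub iu iv,
      ← intervalIntegral.integral_const_mul]
    refine intervalIntegral.norm_integral_le_of_norm_le ht.1 ?_
      ((intervalIntegrable_rpow_sub_mul hφc t).const_mul A)
    -- The smoothing estimate requires `τ = t - s > 0`, so the endpoint is removed as a null set.
    have hne : ∀ᵐ s : ℝ, s ≠ t := by simp [ae_iff, measure_singleton]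
    filter_upwards [hne] with s hst hs
    have hlt : 0 < t - s := sub_pos.2 (lt_of_le_of_ne hs.2 hst)
    refine (norm_semigroupBilin_sub_le hd hB hlt _ _).trans ?_
    have h1 : ‖u s.toNNReal‖ + ‖v s.toNNReal‖ ≤ R :=
      (le_abs_self _).trans (hR s ⟨hs.1.le, hs.2.trans ht.2⟩)
    have h2 : 0 ≤ smoothingConst d := Real.sqrt_nonneg _
    calc _ ≤ smoothingConst d * (t - s) ^ (-(1 / 4) : ℝ) *
          (supNorm B * (2 * Real.pi) * (R * ‖u s.toNNReal - v s.toNNReal‖)) := by gcongr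
      _ = _ := by rw [hA]; ring
  have := eq_zero_of_le_singular_integral hφc (fun s => norm_nonneg _) T.coe_nonneg hA0 key T
    ⟨T.coe_nonneg, le_rfl⟩
  simp only [hφ, Real.toNNReal_coe] at this
  exact sub_eq_zero.1 (norm_eq_zero.1 this)

end

/-! ### The sup norm is bounded by the `L¹` norm of the Fourier transform -/

theorem continuous_neg_innerₗ :
    Continuous fun p : ℝ × ℝ => (-innerₗ ℝ : ℝ →ₗ[ℝ] ℝ →ₗ[ℝ] ℝ) p.1 p.2 := by
  simp only [LinearMap.neg_apply, innerₗ_apply_apply]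
  exact continuous_inner.neg

/-- The inverse Fourier transform of a function in `L¹ ∩ L²` is given by the Fourier integral. -/
theorem ae_eq_fourierInv_integral (u : L2) (hw : Integrable (𝓕 u : L2)) :
    u =ᵐ[volume] 𝓕⁻ ((𝓕 u : L2) : ℝ → ℂ) := by
  set w : L2 := 𝓕 u with hwdef
  have hcont : Continuous (𝓕⁻ (w : ℝ → ℂ)) :=
    VectorFourier.fourierIntegral_continuous Real.continuous_fourierChar
      continuous_neg_innerₗ hw
  refine ae_eq_of_integral_contDiff_smul_eq
    ((Lp.memLp u).locallyIntegrable (by norm_num)) hcont.locallyIntegrable fun ψ hψ hψc => ?_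
  have hψ' : ContDiff ℝ ((⊤ : ℕ∞) : WithTop ℕ∞) (fun x => (ψ x : ℂ)) := Complex.ofRealCLM.contDiff.comp hψ
  have hψc' : HasCompactSupport (fun x => (ψ x : ℂ)) :=
    hψc.comp_left (g := fun r : ℝ => (r : ℂ)) Complex.ofReal_zero
  set Ψ : SchwartzMap ℝ ℂ := hψc'.toSchwartzMap hψ' with hΨ
  -- The `L²` transform agrees with the distributional one; tested on `𝓕⁻ Ψ` this reads `∫ Ψ u = ∫
  -- (𝓕⁻ Ψ) w`. Fubini then moves `𝓕⁻` onto the integrable function `w`.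
  have h1 := DFunLike.congr_fun (Lp.fourier_toTemperedDistribution_eq u) (𝓕⁻ Ψ)
  rw [TemperedDistribution.fourier_apply, fourier_fourierInv_eq, Lp.toTemperedDistribution_apply,
    Lp.toTemperedDistribution_apply] at h1
  have h2 := VectorFourier.integral_fourierIntegral_smul_eq_flip (μ := volume) (ν := volume)
    (L := -innerₗ ℝ) (f := Ψ) (g := w) Real.continuous_fourierChar
    continuous_neg_innerₗ Ψ.integrable hw
  have h3 : (-innerₗ ℝ).flip = -innerₗ ℝ := by
    ext; simp
  rw [h3] at h2
  calc ∫ x, ψ x • u x = ∫ x, Ψ x • u x := by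
        refine integral_congr_ae (Eventually.of_forall fun x => ?_)
        simp [hΨ]
    _ = ∫ x, (𝓕⁻ Ψ) x • w x := h1
    _ = ∫ x, Ψ x • 𝓕⁻ (w : ℝ → ℂ) x := by
        rw [SchwartzMap.fourierInv_coe]; exact h2
    _ = _ := by
        refine integral_congr_ae (Eventually.of_forall fun x => ?_)
        simp [hΨ]

/-- The inversion integral is bounded by the `L¹` norm of the transform; the change of frequency
variable contributes a factor `1/(2π) ≤ 1`. -/
theorem eLpNorm_top_le_eLpNorm_FT (u : L2) (h : MemLp (FT u) 1 volume) :
    eLpNorm u ∞ volume ≤ eLpNorm (FT u) 1 volume := by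
  have hFT : ∀ k, (𝓕 u : L2) k = FT u (2 * Real.pi * k) := fun k => by
    simp only [FT]; congr 1; field_simp
  have hint : Integrable (𝓕 u : L2) := by
    have h1 := memLp_one_iff_integrable.1 (memLp_comp_mul (a := 2 * Real.pi) (by positivity) h)
    exact h1.congr (Eventually.of_forall fun k => (hFT k).symm)
  have hFTint := memLp_one_iff_integrable.1 h
  have hval : ∫ k, ‖(𝓕 u : L2) k‖ ≤ ∫ k, ‖FT u k‖ := by
    simp only [hFT]
    rw [Measure.integral_comp_mul_left (fun k => ‖FT u k‖), smul_eq_mul]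
    refine mul_le_of_le_one_left (integral_nonneg fun k => norm_nonneg _) ?_
    rw [abs_of_pos (by positivity)]
    exact inv_le_one_of_one_le₀ (by linarith [Real.pi_gt_three])
  rw [eLpNorm_exponent_top, eLpNorm_one_eq_lintegral_enorm,
    ← ofReal_integral_norm_eq_lintegral_enorm hFTint]
  refine eLpNormEssSup_le_of_ae_bound ?_
  filter_upwards [ae_eq_fourierInv_integral u hint] with x hx
  rw [hx]
  exact (VectorFourier.norm_fourierIntegral_le_integral_norm _ _ _ _ _).trans hval

end HalfKleinGordon

end

/-! ### Conclusion: choice of constants and the decay rates -/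

theorem theorem1 (d : ℝ) (hd : 0 < d) (B : ℝ × ℝ → ℂ) (hB : MemLp B ∞ volume) :
    ∃ δ : ℝ, 0 < δ ∧ ∃ C : ℝ, 0 < C ∧
      ∀ u₀ : HalfKleinGordon.L2,
        MemLp (HalfKleinGordon.FT u₀) 1 volume →
        MemLp (HalfKleinGordon.FT u₀) ∞ volume →
        HalfKleinGordon.normL1Linf (HalfKleinGordon.FT u₀) ≤ ENNReal.ofReal δ →
        ∃ u : C(ℝ≥0, HalfKleinGordon.L2),
          HalfKleinGordon.IsMildSolution d B u₀ u ∧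
          (∀ v : C(ℝ≥0, HalfKleinGordon.L2),
            HalfKleinGordon.IsMildSolution d B u₀ v → v = u) ∧
          ∀ t : ℝ≥0,
            MemLp (HalfKleinGordon.FT (u t)) 1 volume ∧
            MemLp (HalfKleinGordon.FT (u t)) ∞ volume ∧
            eLpNorm (u t) ∞ volume ≤ eLpNorm (HalfKleinGordon.FT (u t)) 1 volume ∧
            eLpNorm (HalfKleinGordon.FT (u t)) 1 volume ≤
              ENNReal.ofReal (C * (1 + (t : ℝ)) ^ (-(1 / 2) : ℝ)) *
                HalfKleinGordon.normL1Linf (HalfKleinGordon.FT u₀) ∧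
            eLpNorm (u t) 2 volume ≤
              ENNReal.ofReal (C * (1 + (t : ℝ)) ^ (-(1 / 4) : ℝ)) *
                HalfKleinGordon.normL1Linf (HalfKleinGordon.FT u₀) ∧
            eLpNorm (HalfKleinGordon.FT (u t)) ∞ volume ≤
              ENNReal.ofReal C * HalfKleinGordon.normL1Linf (HalfKleinGordon.FT u₀) := by
  open HalfKleinGordon in
  have hC := one_le_estimateConst hd
  set C := estimateConst d with hCdef
  have hC0 : 0 < C := by linarith
  have hM := supNorm_nonneg B
  -- This `δ` enforces `8 C² ‖B̂‖ E ≤ 1`; the `+ 1` covers `B̂ = 0`. The constant `2C` is the radius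
  -- `2CE` divided by `E`.
  refine ⟨1 / (8 * C ^ 2 * (supNorm B + 1)), by positivity, 2 * C, by positivity,
    fun u₀ h1 htop hδ => ?_⟩
  have hfin : normL1Linf (FT u₀) ≠ ∞ := (hδ.trans_lt ENNReal.ofReal_lt_top).ne
  set E := (normL1Linf (FT u₀)).toReal with hE
  have hE0 : 0 ≤ E := ENNReal.toReal_nonneg
  have hEeq : normL1Linf (FT u₀) = ENNReal.ofReal E := (ENNReal.ofReal_toReal hfin).symm
  have hEδ : E ≤ 1 / (8 * C ^ 2 * (supNorm B + 1)) := by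
    rw [hEeq] at hδ
    exact (ENNReal.ofReal_le_ofReal_iff (by positivity)).1 hδ
  set f : L1 := h1.toLp (FT u₀) with hf
  have hfae : FT u₀ =ᵐ[volume] f := h1.coeFn_toLp.symm
  have hf1 : LpBound 1 f E := by
    rw [LpBound, ← eLpNorm_congr_ae hfae, ← hEeq]; exact le_max_left _ _
  have hf2 : LpBound ∞ f E := by
    rw [LpBound, ← eLpNorm_congr_ae hfae, ← hEeq]; exact le_max_right _ _
  have hsmall : 8 * C ^ 2 * supNorm B * E ≤ 1 := by
    rw [le_div_iff₀ (by positivity)] at hEδ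
    have : 0 ≤ 8 * C ^ 2 * E := by positivity
    linarith
  obtain ⟨g, hg, hfix⟩ := exists_demodulated_solution hd hB hE0 hf1 hf2 hsmall
  have hr : 0 ≤ 2 * C * E := by positivity
  obtain ⟨u, hu, hug⟩ := exists_mildSolution hd hB hfae hE0 hr hf2 hg hfix
  refine ⟨u, hu, fun v hv => mildSolution_unique hd hB hv hu, fun t => ?_⟩
  obtain ⟨hinv, hFT⟩ := hug t
  have ht : (0 : ℝ) ≤ t := t.coe_nonneg
  have ht1 : 0 < 1 + (t : ℝ) := by linarith
  have hq := ofReal_mem_quadrant ht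
  have hg1 : LpBound 1 (modulate g t) (2 * C * E * (1 + (t : ℝ)) ^ (-(1 / 2) : ℝ)) := by
    have := (hg.2.1 _ hq).modulate
    rwa [Complex.ofReal_re] at this
  have hg2 : LpBound ∞ (modulate g t) (2 * C * E) := (hg.2.2.1 _ hq).modulate
  have hb1 : eLpNorm (FT (u t)) 1 volume ≤
      ENNReal.ofReal (2 * C * (1 + (t : ℝ)) ^ (-(1 / 2) : ℝ)) * normL1Linf (FT u₀) := by
    rw [hEeq, ← ENNReal.ofReal_mul (by positivity), eLpNorm_congr_ae hFT]
    exact hg1.trans (le_of_eq (by ring_nf))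
  have hb2 : eLpNorm (FT (u t)) ∞ volume ≤ ENNReal.ofReal (2 * C) * normL1Linf (FT u₀) := by
    rw [hEeq, ← ENNReal.ofReal_mul (by positivity), eLpNorm_congr_ae hFT]
    exact hg2
  have hm1 : MemLp (FT (u t)) 1 volume :=
    ⟨(memLp_FT (u t)).1, hb1.trans_lt (ENNReal.mul_lt_top ENNReal.ofReal_lt_top hfin.lt_top)⟩
  refine ⟨hm1, ⟨(memLp_FT (u t)).1,
    hb2.trans_lt (ENNReal.mul_lt_top ENNReal.ofReal_lt_top hfin.lt_top)⟩,
    eLpNorm_top_le_eLpNorm_FT (u t) hm1, hb1, ?_, hb2⟩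
  -- Interpolating the `L¹` rate `-1/2` with the bounded `L^∞` norm halves the exponent.
  have hnorm : ‖u t‖ ≤ 2 * C * (1 + (t : ℝ)) ^ (-(1 / 4) : ℝ) * E := by
    refine le_of_sq_le_sq ?_ (by positivity)
    rw [hinv]
    refine (norm_sq_invFT_le_of_lpBound hr hg2).trans ?_
    have h3 := hg1.norm_le (by positivity)
    have h4 : ((1 + (t : ℝ)) ^ (-(1 / 4) : ℝ)) ^ 2 = (1 + (t : ℝ)) ^ (-(1 / 2) : ℝ) := by
      rw [← Real.rpow_mul_natCast ht1.le]; norm_num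
    calc _ ≤ 2 * C * E * (2 * C * E * (1 + (t : ℝ)) ^ (-(1 / 2) : ℝ)) := by gcongr
      _ = _ := by rw [← h4]; ring
  rw [hEeq, ← ENNReal.ofReal_mul (by positivity),
    ← ENNReal.ofReal_toReal (Lp.eLpNorm_ne_top (u t)), ← Lp.norm_def]
  exact ENNReal.ofReal_le_ofReal hnorm
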